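/- Let $d\ge 0$, $\hbar>0$, $m>0$, and let $V\in C^3(\mathbb R^d)$. Write $z=(q,p)\in\mathbb R^{2d}$, $\mathbb J=\begin{bmatrix}0&I_d\\-I_d&0\end{bmatrix}$, $\Omega_{\mathbb R^{2d}}(z_1,z_2)=z_1\cdot\mathbb J z_2$, and let $\mathsf{sym}(n,\mathbb R)$ be the space of real symmetric $n\times n$ matrices. Let $\mathbb H_d=\{\mathcal C=\mathcal A+\mathrm i\mathcal B:\mathcal A,\mathcal B\in\mathsf{sym}(d,\mathbb R),\ \mathcal B>0\}$, on which $\mathsf{Sp}(\mathbb R^{2d})$ acts by $\Phi_S(\mathcal C)=(S_{21}+S_{22}\mathcal C)(S_{11}+S_{12}\mathcal C)^{-1}$, and let $$\sigma(\mathcal C)=\begin{bmatrix}\mathcal B^{-1}&\mathcal B^{-1}\mathcal A\\ \mathcal A\mathcal B^{-1}&\mathcal A\mathcal B^{-1}\mathcal A+\mathcal B\end{bmatrix}.$$ Let $\mathcal P=\mathbb R^{2d}\times\mathbb H_d$ carry the symplectic form $\Omega=\Omega_{\mathbb R^{2d}}-\frac\hbar4\Omega_{\mathbb H_d}$, where $\Omega_{\mathbb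 H_d}=-\sum_{j,k}\mathbf d(\mathcal B^{-1})_{jk}\wedge\mathbf d\mathcal A_{jk}$, and the Poisson bracket $\{F,G\}_{\mathcal P}=\Omega(X_F,X_G)$, where $\Omega(X_F,\cdot)=\mathbf dF$. On $\mathsf{sym}(2d,\mathbb R)$ put $[\xi,\eta]=\xi\mathbb J^T\eta-\eta\mathbb J^T\xi$ and identify it with $\mathfrak{sp}(\mathbb R^{2d})$ by $\xi\mapsto\mathbb J^T\xi$; put $\mathrm{ad}^*_\xi\mu=\mathbb J\xi\mu-\mu\xi\mathbb J$ and $\mathrm{Ad}^*_{S^{-1}}\mu=S\mu S^T$. A coadjoint orbit $\mathcal O\subset\mathsf{sym}(2d,\mathbb R)$ has tangent spaces $T_\mu\mathcal O=\{\mathrm{ad}^*_\xi\mu\}$ and carries the form $\Omega^+_{\mathcal O}(\mu)(\mathrm{ad}^*_\xi\mu,\mathrm{ad}^*_\eta\mu)=\mathrm{tr}(\mu[\xi,\eta])$. On $\mathbb R^{2d}\times\mathsf{sym}(2d,\mathbb R)=\{(z,\Sigma)\}$ let $$\{f,g\}=\{f,g\}_{\mathbb R^{2d}}-\tfrac4\hbar\,\mathrm{tr}\bigl(\Sigma\,[\tfrac{\delta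 f}{\delta\Sigma},\tfrac{\delta g}{\delta\Sigma}]\bigr),$$ where $\{\cdot,\cdot\}_{\mathbb R^{2d}}$ is the canonical bracket in $(q,p)$ and $\delta f/\delta\Sigma$ is the gradient with respect to the inner product $\mathrm{tr}(\xi\eta)$. Let $\mathsf G=\mathbb R^{2d}\times\mathsf{Sp}(\mathbb R^{2d})$ (direct product). It acts on $\mathcal P$ by $\Psi_{(\delta z,S)}(z,\mathcal C)=(z+\mathbb J\delta z,\Phi_S(\mathcal C))$ and on $\mathbb R^{2d}\times\mathsf{sym}(2d,\mathbb R)$ by $(\delta z,S)\cdot(z,\Sigma)=(z+\mathbb J\delta z,\mathrm{Ad}^*_{S^{-1}}\Sigma)$. The dual of the Lie algebra $\mathbb R^{2d}\times\mathsf{sym}(2d,\mathbb R)$ of $\mathsf G$ is identified with $\mathbb R^{2d}\times\mathsf{sym}(2d,\mathbb R)$ by the pairing $\langle(z,\Sigma),(\delta z,\xi)\rangle=z\cdot\delta z-\frac\hbar4\mathrm{tr}(\Sigma\xi)$. Then: (i) The momentum map of $\Psi$ on $(\mathcal P,\Omega)$, that is, the smooth map $\mathbf M:\mathcal P\to\mathbb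 R^{2d}\times\mathsf{sym}(2d,\mathbb R)$, unique up to an additive constant, with $\Omega(a_{\mathcal P},\cdot)=\mathbf d\langle\mathbf M,a\rangle$ for every $a$ in the Lie algebra of $\mathsf G$ with infinitesimal generator $a_{\mathcal P}$, is $\mathbf M(z,\mathcal C)=(z,\sigma(\mathcal C))$, and $\mathbf M$ is equivariant for the two actions of $\mathsf G$ above. (ii) $\mathbf M$ is Poisson: $\{f\circ\mathbf M,g\circ\mathbf M\}_{\mathcal P}=\{f,g\}\circ\mathbf M$ for all $f,g\in C^\infty(\mathbb R^{2d}\times\mathsf{sym}(2d,\mathbb R))$. (iii) Let $\mathcal O$ be the coadjoint orbit that contains some $\sigma(\mathcal C)$, and let $\omega=\Omega_{\mathbb R^{2d}}-\frac\hbar4\Omega^+_{\mathcal O}$ on $\mathbb R^{2d}\times\mathcal O$. Then $\mathbf M$ maps $\mathcal P$ into $\mathbb R^{2d}\times\mathcal O$, and $\mathbf M^*\omega=\Omega$. (iv) Let $H=\frac{p^2}{2m}+V(q)+\frac\hbar4\mathrm{tr}\bigl[\mathcal B^{-1}\bigl(\frac{\mathcal A^2+\mathcal B^2}m+D^2V(q)\bigr)\bigr]$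 on $\mathcal P$, let $H_{\rm cl}(q,p)=\frac{p^2}{2m}+V(q)$, and let $\mathcal O_\Sigma$ be the coadjoint orbit through $\Sigma=\sigma(\mathcal C)$ for some $\mathcal C\in\mathbb H_d$. The equation $X_h\circ\mathbf M=T\mathbf M\circ X_H$ defines exactly one vector field $X_h$ on $\mathbb R^{2d}\times\mathcal O_\Sigma$. It is the Hamiltonian vector field, $\omega(X_h,\cdot)=\mathbf dh$, of $$h(z,\Sigma)=H_{\rm cl}(z)+\tfrac\hbar4\mathrm{tr}(\Sigma\,D^2H_{\rm cl}(z))=\frac{p^2}{2m}+V(q)+\frac\hbar4\,\mathrm{tr}\Bigl(\frac{\Sigma_{22}}m+\Sigma_{11}D^2V(q)\Bigr),$$ and it is given by $\dot z=\{z,h\}_{\mathbb R^{2d}}$, $\dot\Sigma=\frac4\hbar\,\mathrm{ad}^*_{\delta h/\delta\Sigma}\Sigma=\frac4\hbar\bigl(\mathbb J\frac{\delta h}{\delta\Sigma}\Sigma-\Sigma\frac{\delta h}{\delta\Sigma}\mathbb J\bigr)$, that is, $$\dot q=\frac pm,\qquad \dot p=-\frac{\partial}{\partial q}\Bigl[V(q)+\frac\hbar4\mathrm{tr}(\Sigma_{11}D^2V(q))\Bigr],\qquad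 \dot\Sigma=\mathbb J\,D^2H_{\rm cl}(z)\,\Sigma-\Sigma\,D^2H_{\rm cl}(z)\,\mathbb J .$$ -/

import Mathlib

open Matrix
open scoped ContDiff

attribute [local instance] Matrix.normedAddCommGroup Matrix.normedSpace

noncomputable section

namespace GWP

/-! ### Symmetric matrices, the matrix `𝕁`, the phase space -/

/-- The real vector space `sym(n, ℝ)` of symmetric real matrices. -/
def symSubmodule (n : Type) : Submodule ℝ (Matrix n n ℝ) where
  carrier := {A | Aᵀ = A}
  add_mem' {a b} ha hb := by
    simp only [Set.mem_ofPred_eq, transpose_add] at *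
    rw [ha, hb]
  zero_mem' := by simp
  smul_mem' c a ha := by
    simp only [Set.mem_ofPred_eq, transpose_smul] at *
    rw [ha]

abbrev Sym (n : Type) : Type := symSubmodule n

theorem Sym.transpose_eq {n : Type} (A : Sym n) : (A : Matrix n n ℝ)ᵀ = A := A.2

/-- `𝕁 = [[0, I], [-I, 0]]`. -/
def JJ (d : ℕ) : Matrix (Fin d ⊕ Fin d) (Fin d ⊕ Fin d) ℝ := fromBlocks 0 1 (-1) 0

theorem JJ_eq (d : ℕ) : JJ d = -Matrix.J (Fin d) ℝ := by
  rw [JJ, Matrix.J, fromBlocks_neg]; simp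

theorem JJ_transpose (d : ℕ) : (JJ d)ᵀ = -JJ d := by
  rw [JJ_eq]; simp

/-- `ℝ^{2d} = {z = (q, p)}`, with `q = z ∘ Sum.inl` and `p = z ∘ Sum.inr`. -/
abbrev PhaseSpace (d : ℕ) : Type := Fin d ⊕ Fin d → ℝ

/-- The Lie algebra / dual space `sym(2d, ℝ)`. -/
abbrev Sym2 (d : ℕ) : Type := Sym (Fin d ⊕ Fin d)

/-! ### The Siegel upper half space and `𝒫 = ℝ^{2d} × ℍ_d` -/

/-- The real vector space of pairs `(𝒜, ℬ)`, in which `ℍ_d` is an open subset. -/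
abbrev SiegelModel (d : ℕ) : Type := Sym (Fin d) × Sym (Fin d)

/-- The Siegel upper half space, `𝒞 = 𝒜 + iℬ` being recorded as the pair `(𝒜, ℬ)`. -/
def siegel (d : ℕ) : Set (SiegelModel d) := {c | (c.2 : Matrix (Fin d) (Fin d) ℝ).PosDef}

/-- The complex matrix `𝒞 = 𝒜 + iℬ`. -/
def toComplex {d : ℕ} (c : SiegelModel d) : Matrix (Fin d) (Fin d) ℂ :=
  (c.1 : Matrix (Fin d) (Fin d) ℝ).map Complex.ofReal +
    Complex.I • (c.2 : Matrix (Fin d) (Fin d) ℝ).map Complex.ofReal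

/-- The vector space that contains `𝒫` as an open subset; all its tangent spaces. -/
abbrev PModel (d : ℕ) : Type := PhaseSpace d × SiegelModel d

/-- `𝒫 = ℝ^{2d} × ℍ_d`. -/
def P (d : ℕ) : Set (PModel d) := {x | x.2 ∈ siegel d}

/-- The space `ℝ^{2d} × sym(2d, ℝ) = {(z, Σ)}` of Gaussian moments. -/
abbrev Moments (d : ℕ) : Type := PhaseSpace d × Sym2 d

/-! ### The action of the symplectic group on the Siegel upper half space -/

/-- `S₂₁ + S₂₂ 𝒞`. -/
def numer {d : ℕ} (S : Matrix (Fin d ⊕ Fin d) (Fin d ⊕ Fin d) ℝ) (c : SiegelModel d) :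
    Matrix (Fin d) (Fin d) ℂ :=
  S.toBlocks₂₁.map Complex.ofReal + S.toBlocks₂₂.map Complex.ofReal * toComplex c

/-- `S₁₁ + S₁₂ 𝒞`. -/
def denom {d : ℕ} (S : Matrix (Fin d ⊕ Fin d) (Fin d ⊕ Fin d) ℝ) (c : SiegelModel d) :
    Matrix (Fin d) (Fin d) ℂ :=
  S.toBlocks₁₁.map Complex.ofReal + S.toBlocks₁₂.map Complex.ofReal * toComplex c

/-- `(S₂₁ + S₂₂ 𝒞)(S₁₁ + S₁₂ 𝒞)⁻¹`. -/
def mobius {d : ℕ} (S : Matrix (Fin d ⊕ Fin d) (Fin d ⊕ Fin d) ℝ) (c : SiegelModel d) :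
    Matrix (Fin d) (Fin d) ℂ :=
  numer S c * (denom S c)⁻¹

theorem toComplex_transpose {d : ℕ} (c : SiegelModel d) : (toComplex c)ᵀ = toComplex c := by
  simp only [toComplex, transpose_add, transpose_smul, ← transpose_map, Sym.transpose_eq]

theorem toComplex_conjTranspose {d : ℕ} (c : SiegelModel d) :
    (toComplex c)ᴴ = (c.1 : Matrix (Fin d) (Fin d) ℝ).map Complex.ofReal -
      Complex.I • (c.2 : Matrix (Fin d) (Fin d) ℝ).map Complex.ofReal := by
  have h : (toComplex c)ᴴ = ((toComplex c)ᵀ).map star := rfl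
  rw [h, toComplex_transpose]
  ext i j
  simp [toComplex, sub_eq_add_neg]

/-- A real matrix has the same conjugate transpose as transpose. -/
theorem map_ofReal_conjTranspose {d : ℕ} (A : Matrix (Fin d) (Fin d) ℝ) :
    (A.map Complex.ofReal)ᴴ = Aᵀ.map Complex.ofReal := by
  ext i j; simp

theorem block_relations {d : ℕ} (S : Matrix.symplecticGroup (Fin d) ℝ) :
    S.1.toBlocks₁₁ᵀ * S.1.toBlocks₂₁ = S.1.toBlocks₂₁ᵀ * S.1.toBlocks₁₁ ∧
    S.1.toBlocks₁₂ᵀ * S.1.toBlocks₂₂ = S.1.toBlocks₂₂ᵀ * S.1.toBlocks₁₂ ∧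
    S.1.toBlocks₁₁ᵀ * S.1.toBlocks₂₂ - S.1.toBlocks₂₁ᵀ * S.1.toBlocks₁₂ = 1 := by
  rw [← SymplecticGroup.fromBlocks_mem_iff, fromBlocks_toBlocks]
  exact S.2

/-- For real blocks satisfying the symplectic relations,
`(a + D b)(c' + d' C) - (a' + D b')(…)` collapses to `C - D`. -/
theorem collapse {d : ℕ} (S : Matrix.symplecticGroup (Fin d) ℝ)
    (C D : Matrix (Fin d) (Fin d) ℂ) :
    (S.1.toBlocks₁₁ᵀ.map Complex.ofReal + D * S.1.toBlocks₁₂ᵀ.map Complex.ofReal) *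
        (S.1.toBlocks₂₁.map Complex.ofReal + S.1.toBlocks₂₂.map Complex.ofReal * C) -
      (S.1.toBlocks₂₁ᵀ.map Complex.ofReal + D * S.1.toBlocks₂₂ᵀ.map Complex.ofReal) *
        (S.1.toBlocks₁₁.map Complex.ofReal + S.1.toBlocks₁₂.map Complex.ofReal * C) =
      C - D := by
  obtain ⟨h1, h2, h3⟩ := block_relations S
  have h4 : S.1.toBlocks₂₂ᵀ * S.1.toBlocks₁₁ - S.1.toBlocks₁₂ᵀ * S.1.toBlocks₂₁ = 1 := by
    have := congrArg Matrix.transpose h3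
    simpa [transpose_sub, transpose_mul] using this
  have e : ∀ A B : Matrix (Fin d) (Fin d) ℝ, (A * B).map Complex.ofReal =
      A.map Complex.ofReal * B.map Complex.ofReal := fun A B =>
    Matrix.map_mul (f := Complex.ofRealHom)
  have es : ∀ A B : Matrix (Fin d) (Fin d) ℝ, (A - B).map Complex.ofReal =
      A.map Complex.ofReal - B.map Complex.ofReal := fun A B => by ext i j; simp
  have e1 : (1 : Matrix (Fin d) (Fin d) ℝ).map Complex.ofReal = 1 :=
    Matrix.map_one _ (by simp) (by simp)
  have g1 := congrArg (fun A => A.map Complex.ofReal) h1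
  have g2 := congrArg (fun A => A.map Complex.ofReal) h2
  have g3 := congrArg (fun A => A.map Complex.ofReal) h3
  have g4 := congrArg (fun A => A.map Complex.ofReal) h4
  simp only [e, es, e1] at g1 g2 g3 g4
  generalize S.1.toBlocks₁₁ᵀ.map Complex.ofReal = a at *
  generalize S.1.toBlocks₁₂ᵀ.map Complex.ofReal = b at *
  generalize S.1.toBlocks₂₁ᵀ.map Complex.ofReal = a' at *
  generalize S.1.toBlocks₂₂ᵀ.map Complex.ofReal = b' at *
  generalize S.1.toBlocks₁₁.map Complex.ofReal = p at *
  generalize S.1.toBlocks₁₂.map Complex.ofReal = q at *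
  generalize S.1.toBlocks₂₁.map Complex.ofReal = r at *
  generalize S.1.toBlocks₂₂.map Complex.ofReal = s at *
  have key : (a + D * b) * (r + s * C) - (a' + D * b') * (p + q * C) =
      (a * r - a' * p) + (a * s - a' * q) * C - D * (b' * p - b * r) +
        D * (b * s - b' * q) * C := by noncomm_ring
  rw [key, g1, g2, g3, g4]
  noncomm_ring

theorem denom_transpose {d : ℕ} (S : Matrix.symplecticGroup (Fin d) ℝ) (c : SiegelModel d) :
    (denom S.1 c)ᵀ * numer S.1 c = (numer S.1 c)ᵀ * denom S.1 c := by
  have h := collapse S (toComplex c) (toComplex c)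
  rw [sub_self, sub_eq_zero] at h
  simpa only [denom, numer, transpose_add, transpose_mul, toComplex_transpose,
    ← transpose_map] using h

theorem denom_conjTranspose {d : ℕ} (S : Matrix.symplecticGroup (Fin d) ℝ)
    (c : SiegelModel d) :
    (denom S.1 c)ᴴ * numer S.1 c - (numer S.1 c)ᴴ * denom S.1 c =
      (2 * Complex.I) • (c.2 : Matrix (Fin d) (Fin d) ℝ).map Complex.ofReal := by
  have h := collapse S (toComplex c) ((toComplex c)ᴴ)
  simp only [denom, numer, conjTranspose_add, conjTranspose_mul, map_ofReal_conjTranspose]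
  rw [h, toComplex_conjTranspose, toComplex, two_mul, add_smul]
  abel

theorem quad_pos {d : ℕ} {B : Matrix (Fin d) (Fin d) ℝ} (hB : B.PosDef) {v : Fin d → ℂ}
    (hv : v ≠ 0) : 0 < (star v ⬝ᵥ (B.map Complex.ofReal *ᵥ v)).re := by
  have key : (star v ⬝ᵥ (B.map Complex.ofReal *ᵥ v)).re =
      (fun i => (v i).re) ⬝ᵥ (B *ᵥ fun i => (v i).re) +
        (fun i => (v i).im) ⬝ᵥ (B *ᵥ fun i => (v i).im) := by
    simp only [dotProduct, mulVec, Complex.re_sum, Finset.mul_sum, Pi.star_apply,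
      ← Finset.sum_add_distrib]
    refine Finset.sum_congr rfl fun i _ => Finset.sum_congr rfl fun j _ => ?_
    simp
  rw [key]
  have nn : ∀ x : Fin d → ℝ, 0 ≤ x ⬝ᵥ (B *ᵥ x) := fun x => by
    simpa using hB.posSemidef.dotProduct_mulVec_nonneg x
  have pp : ∀ x : Fin d → ℝ, x ≠ 0 → 0 < x ⬝ᵥ (B *ᵥ x) := fun x hx => by
    simpa using hB.dotProduct_mulVec_pos hx
  by_cases h : (fun i => (v i).re) = 0
  · have h' : (fun i => (v i).im) ≠ 0 := fun h' => hv (funext fun i =>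
      Complex.ext (congrFun h i) (congrFun h' i))
    exact add_pos_of_nonneg_of_pos (nn _) (pp _ h')
  · exact add_pos_of_pos_of_nonneg (pp _ h) (nn _)

theorem denom_isUnit {d : ℕ} (S : Matrix.symplecticGroup (Fin d) ℝ) (c : SiegelModel d)
    (hc : c ∈ siegel d) : IsUnit (denom S.1 c) := by
  rw [Matrix.isUnit_iff_isUnit_det, isUnit_iff_ne_zero]
  intro h0
  obtain ⟨v, hv, hv0⟩ := Matrix.exists_mulVec_eq_zero_iff.2 h0
  have hp := quad_pos hc hv
  have h := congrArg (fun A => star v ⬝ᵥ (A *ᵥ v)) (denom_conjTranspose S c)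
  have h1 : star v ⬝ᵥ (((denom S.1 c)ᴴ * numer S.1 c) *ᵥ v) = 0 := by
    rw [← mulVec_mulVec, dotProduct_mulVec, ← star_mulVec, hv0]; simp
  have h2 : star v ⬝ᵥ (((numer S.1 c)ᴴ * denom S.1 c) *ᵥ v) = 0 := by
    rw [← mulVec_mulVec, hv0]; simp
  simp only [sub_mulVec, dotProduct_sub, h1, h2, smul_mulVec, dotProduct_smul] at h
  rw [sub_zero] at h
  have : (2 * Complex.I) ≠ 0 := by simp
  rcases smul_eq_zero.1 h.symm with h' | h'
  · exact this h'
  · rw [h'] at hp; simp at hp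

theorem mobius_transpose {d : ℕ} (S : Matrix.symplecticGroup (Fin d) ℝ) (c : SiegelModel d)
    (hc : c ∈ siegel d) : (mobius S.1 c)ᵀ = mobius S.1 c := by
  have hu := denom_isUnit S c hc
  have hd : IsUnit (denom S.1 c).det := (Matrix.isUnit_iff_isUnit_det _).1 hu
  have hdT : IsUnit (denom S.1 c)ᵀ.det := by rwa [det_transpose]
  have h := denom_transpose S c
  rw [mobius, transpose_mul, transpose_nonsing_inv]
  calc ((denom S.1 c)ᵀ)⁻¹ * (numer S.1 c)ᵀ
      = ((denom S.1 c)ᵀ)⁻¹ * ((numer S.1 c)ᵀ * denom S.1 c) * (denom S.1 c)⁻¹ := by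
        rw [← Matrix.mul_assoc, mul_nonsing_inv_cancel_right _ _ hd]
    _ = numer S.1 c * (denom S.1 c)⁻¹ := by
        rw [← h, nonsing_inv_mul_cancel_left _ _ hdT]

theorem mobius_im {d : ℕ} (S : Matrix.symplecticGroup (Fin d) ℝ) (c : SiegelModel d)
    (hc : c ∈ siegel d) :
    ((mobius S.1 c).map Complex.im).map Complex.ofReal =
      ((denom S.1 c)⁻¹)ᴴ * (c.2 : Matrix (Fin d) (Fin d) ℝ).map Complex.ofReal *
        (denom S.1 c)⁻¹ := by
  have hu := denom_isUnit S c hc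
  have hd : IsUnit (denom S.1 c).det := (Matrix.isUnit_iff_isUnit_det _).1 hu
  have hdH : IsUnit (denom S.1 c)ᴴ.det := by
    rw [det_conjTranspose]; exact hd.star
  have h2 : (2 * Complex.I) ≠ 0 := by simp
  have e1 : mobius S.1 c - (mobius S.1 c)ᴴ =
      (2 * Complex.I) • ((mobius S.1 c).map Complex.im).map Complex.ofReal := by
    have h : (mobius S.1 c)ᴴ = ((mobius S.1 c)ᵀ).map star := rfl
    rw [h, mobius_transpose S c hc]
    ext i j
    rw [Matrix.sub_apply, Matrix.smul_apply, map_apply, map_apply, map_apply, smul_eq_mul]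
    apply Complex.ext <;> simp
    ring
  have e2 : mobius S.1 c - (mobius S.1 c)ᴴ = (2 * Complex.I) •
      (((denom S.1 c)⁻¹)ᴴ * (c.2 : Matrix (Fin d) (Fin d) ℝ).map Complex.ofReal *
        (denom S.1 c)⁻¹) := by
    rw [← Matrix.smul_mul, ← Matrix.mul_smul, ← denom_conjTranspose S c, mobius,
      conjTranspose_mul, conjTranspose_nonsing_inv, Matrix.mul_sub, Matrix.sub_mul,
      ← Matrix.mul_assoc, ← Matrix.mul_assoc, nonsing_inv_mul _ hdH, Matrix.one_mul,
      mul_nonsing_inv_cancel_right _ _ hd]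
  exact smul_right_injective _ h2 (e1.symm.trans e2)

theorem mobius_im_posDef {d : ℕ} (S : Matrix.symplecticGroup (Fin d) ℝ) (c : SiegelModel d)
    (hc : c ∈ siegel d) : ((mobius S.1 c).map Complex.im).PosDef := by
  refine PosDef.of_dotProduct_mulVec_pos ?_ fun {w} hw => ?_
  · change ((mobius S.1 c).map Complex.im)ᴴ = _
    rw [conjTranspose_eq_transpose_of_trivial, ← transpose_map, mobius_transpose S c hc]
  · have hd : IsUnit (denom S.1 c).det :=
      (Matrix.isUnit_iff_isUnit_det _).1 (denom_isUnit S c hc)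
    have hu : (denom S.1 c)⁻¹ *ᵥ (fun i => (w i : ℂ)) ≠ 0 := by
      intro h
      have h' := congrArg (fun x => denom S.1 c *ᵥ x) h
      simp only [mulVec_mulVec, mul_nonsing_inv _ hd, one_mulVec, mulVec_zero] at h'
      exact hw (funext fun i => by simpa using congrFun h' i)
    have hp := quad_pos hc hu
    rw [star_mulVec, ← dotProduct_mulVec, mulVec_mulVec, mulVec_mulVec,
      ← mobius_im S c hc] at hp
    have e : ∀ A : Matrix (Fin d) (Fin d) ℝ, ((star fun i => (w i : ℂ)) ⬝ᵥ
        (A.map Complex.ofReal *ᵥ fun i => (w i : ℂ))).re = star w ⬝ᵥ (A *ᵥ w) := fun A => by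
      simp [dotProduct, mulVec, Finset.mul_sum]
    rwa [e] at hp

/-- The action `Φ_S(𝒞) = (S₂₁ + S₂₂ 𝒞)(S₁₁ + S₁₂ 𝒞)⁻¹`. -/
def Phi {d : ℕ} (S : Matrix.symplecticGroup (Fin d) ℝ) (c : siegel d) : siegel d :=
  ⟨(⟨(mobius S.1 c.1).map Complex.re, by
      change ((mobius S.1 c.1).map Complex.re)ᵀ = _
      rw [← transpose_map, mobius_transpose S c.1 c.2]⟩,
    ⟨(mobius S.1 c.1).map Complex.im, by
      change ((mobius S.1 c.1).map Complex.im)ᵀ = _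
      rw [← transpose_map, mobius_transpose S c.1 c.2]⟩),
    mobius_im_posDef S c.1 c.2⟩

/-! ### The group `G = ℝ^{2d} × Sp(ℝ^{2d})`, its action on `𝒫`, and its exponential map -/

abbrev G (d : ℕ) : Type :=
  Multiplicative (PhaseSpace d) × Matrix.symplecticGroup (Fin d) ℝ

/-- `Ψ_{(δz, S)}(z, 𝒞) = (z + 𝕁 δz, Φ_S(𝒞))`. -/
def Psi {d : ℕ} (g : G d) (x : P d) : P d :=
  ⟨(x.1.1 + JJ d *ᵥ g.1.toAdd, (Phi g.2 ⟨x.1.2, x.2⟩).1), (Phi g.2 ⟨x.1.2, x.2⟩).2⟩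

/-- The identification `ξ ↦ ξ̃ = 𝕁ᵀ ξ` of `sym(2d, ℝ)` with the Lie algebra `sp(ℝ^{2d})`. -/
def tilde {d : ℕ} (ξ : Sym2 d) : Matrix (Fin d ⊕ Fin d) (Fin d ⊕ Fin d) ℝ :=
  (JJ d)ᵀ * (ξ : Matrix (Fin d ⊕ Fin d) (Fin d ⊕ Fin d) ℝ)

theorem exp_tilde_mem {d : ℕ} (ξ : Sym2 d) :
    NormedSpace.exp (tilde ξ) ∈ Matrix.symplecticGroup (Fin d) ℝ := by
  have hJu : IsUnit (Matrix.J (Fin d) ℝ) :=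
    (Matrix.isUnit_iff_isUnit_det _).2 (Matrix.isUnit_det_J _ _)
  have hconj : Matrix.J (Fin d) ℝ * (tilde ξ)ᵀ * (Matrix.J (Fin d) ℝ)⁻¹ = -tilde ξ := by
    rw [tilde, transpose_mul, transpose_transpose, Sym.transpose_eq, JJ_transpose, JJ_eq,
      Matrix.J_inv]
    simp only [Matrix.mul_neg, Matrix.neg_mul, neg_neg, Matrix.mul_assoc, Matrix.J_squared,
      Matrix.mul_one]
  have h := Matrix.exp_conj (Matrix.J (Fin d) ℝ) (tilde ξ)ᵀ hJu
  rw [hconj, Matrix.exp_neg, Matrix.exp_transpose] at h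
  have hu : IsUnit (NormedSpace.exp (tilde ξ)).det :=
    (Matrix.isUnit_iff_isUnit_det _).1 (Matrix.isUnit_exp _)
  rw [SymplecticGroup.mem_iff, Matrix.mul_assoc]
  have h2 : Matrix.J (Fin d) ℝ * (NormedSpace.exp (tilde ξ))ᵀ =
      (NormedSpace.exp (tilde ξ))⁻¹ * Matrix.J (Fin d) ℝ := by
    rw [h, Matrix.mul_assoc, Matrix.nonsing_inv_mul _ (Matrix.isUnit_det_J _ _),
      Matrix.mul_one]
  rw [h2, ← Matrix.mul_assoc, Matrix.mul_nonsing_inv _ hu, Matrix.one_mul]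

/-- The exponential map of `G`, on its Lie algebra `ℝ^{2d} × sp(ℝ^{2d}) ≅ ℝ^{2d} × sym(2d, ℝ)`. -/
def expG {d : ℕ} (a : PhaseSpace d × Sym2 d) : G d :=
  (Multiplicative.ofAdd a.1, ⟨NormedSpace.exp (tilde a.2), exp_tilde_mem a.2⟩)

/-- The curve `ε ↦ Ψ_{exp(ε a)}(x)`. -/
def orbitCurve {d : ℕ} (a : PhaseSpace d × Sym2 d) (x : P d) (ε : ℝ) : PModel d :=
  (Psi (expG (ε • a)) x).1

/-- The infinitesimal generator `a_𝒫(x) = d/dε|₀ Ψ_{exp(ε a)}(x)`. -/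
def infGen {d : ℕ} (a : PhaseSpace d × Sym2 d) (x : P d) : PModel d :=
  deriv (orbitCurve a x) 0

/-! ### Symplectic form, Hamiltonian vector fields and Poisson bracket on `𝒫` -/

/-- `Ω_{ℝ^{2d}}(z₁, z₂) = z₁ · 𝕁 z₂ = q₁ · p₂ - q₂ · p₁`. -/
def OmegaR {d : ℕ} (u v : PhaseSpace d) : ℝ := u ⬝ᵥ (JJ d *ᵥ v)

/-- `Ω_{ℍ_d} = ℬ⁻¹_{lj} ℬ⁻¹_{km} dℬ_{lm} ∧ d𝒜_{jk} = -dℬ⁻¹_{jk} ∧ d𝒜_{jk}` at `c = (𝒜, ℬ)`. -/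
def OmegaH {d : ℕ} (c u v : SiegelModel d) : ℝ :=
  let Binv : Matrix (Fin d) (Fin d) ℝ := (c.2 : Matrix (Fin d) (Fin d) ℝ)⁻¹
  trace (Binv * (u.2 : Matrix (Fin d) (Fin d) ℝ) * Binv * (v.1 : Matrix (Fin d) (Fin d) ℝ)) -
    trace (Binv * (v.2 : Matrix (Fin d) (Fin d) ℝ) * Binv * (u.1 : Matrix (Fin d) (Fin d) ℝ))

/-- The symplectic form `Ω = Ω_{ℝ^{2d}} - (ħ/4) Ω_{ℍ_d}` on `𝒫`, at the point `x`. -/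
def Omega {d : ℕ} (ħ : ℝ) (x u v : PModel d) : ℝ :=
  OmegaR u.1 v.1 - ħ / 4 * OmegaH x.2 u.2 v.2

/-- The value at `x` of the Hamiltonian vector field of `F`: the vector `X` with
`Ω(X, ·) = dF`. By `existsUnique_hamVec` below there is exactly one if `x ∈ 𝒫` and `ħ ≠ 0`. -/
def hamVec {d : ℕ} (ħ : ℝ) (F : PModel d → ℝ) (x : PModel d) : PModel d :=
  Classical.epsilon fun X => ∀ v, Omega ħ x X v = fderiv ℝ F x v

/-- `{F, G}_𝒫 = Ω(X_F, X_G)`. -/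
def poissonP {d : ℕ} (ħ : ℝ) (F K : PModel d → ℝ) (x : PModel d) : ℝ :=
  Omega ħ x (hamVec ħ F x) (hamVec ħ K x)

/-! ### Gradients -/

/-- The symmetric matrix `(E_{ij} + E_{ji}) / 2`. -/
def symUnit {n : Type} [DecidableEq n] (i j : n) : Sym n :=
  ⟨(1 / 2 : ℝ) • (Matrix.single i j 1 + Matrix.single j i 1), by
    change ((1 / 2 : ℝ) • (Matrix.single i j (1 : ℝ) + Matrix.single j i 1))ᵀ = _
    rw [transpose_smul, transpose_add, transpose_single, transpose_single, add_comm]⟩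

/-- The symmetric matrix that represents a linear form `ℓ` on `sym(n, ℝ)` by the pairing
`⟨ξ, η⟩ = tr(ξ η)`; see `trace_symGrad_mul`. -/
def symGrad {n : Type} [DecidableEq n] (ℓ : Sym n →ₗ[ℝ] ℝ) : Sym n :=
  ⟨Matrix.of fun i j => ℓ (symUnit i j), by
    change (Matrix.of fun i j => ℓ (symUnit i j))ᵀ = _
    ext i j
    simp only [transpose_apply, of_apply]
    congr 1
    apply Subtype.ext
    simp only [symUnit, add_comm]⟩

theorem trace_symGrad_mul {n : Type} [Fintype n] [DecidableEq n] (ℓ : Sym n →ₗ[ℝ] ℝ)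
    (η : Sym n) : trace ((symGrad ℓ : Matrix n n ℝ) * (η : Matrix n n ℝ)) = ℓ η := by
  have hη : η = ∑ i, ∑ j, (η : Matrix n n ℝ) j i • symUnit i j := by
    apply Subtype.ext
    ext a b
    have hs : (η : Matrix n n ℝ) a b = (η : Matrix n n ℝ) b a := by
      conv_lhs => rw [← Sym.transpose_eq η]
      rfl
    simp only [Submodule.coe_sum, Submodule.coe_smul, symUnit, Matrix.sum_apply,
      Matrix.smul_apply, Matrix.add_apply, Matrix.single_apply, smul_eq_mul]
    simp only [mul_add, Finset.sum_add_distrib, ite_and, mul_ite, mul_one, mul_zero,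
      Finset.sum_ite_irrel, Finset.sum_const_zero, Finset.sum_ite_eq', Finset.mem_univ, if_true]
    rw [← hs]; ring
  conv_rhs => rw [hη]
  simp only [map_sum, map_smul, trace, diag, Matrix.mul_apply, symGrad, of_apply, smul_eq_mul]
  exact Finset.sum_congr rfl fun i _ => Finset.sum_congr rfl fun j _ => mul_comm _ _

/-- The partial derivative `∂f/∂x_i`. -/
def pderiv {ι : Type} [Fintype ι] [DecidableEq ι] (f : (ι → ℝ) → ℝ) (i : ι) (x : ι → ℝ) : ℝ :=
  fderiv ℝ f x (Pi.single i 1)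

/-- The Hessian matrix `D²f(x)`. -/
def hessian {ι : Type} [Fintype ι] [DecidableEq ι] (f : (ι → ℝ) → ℝ) (x : ι → ℝ) :
    Matrix ι ι ℝ :=
  Matrix.of fun i j => pderiv (pderiv f j) i x

/-- The partial derivative `∂f/∂z_i` of a function of `(z, Σ)`. -/
def dz {d : ℕ} (f : Moments d → ℝ) (w : Moments d) (i : Fin d ⊕ Fin d) : ℝ :=
  fderiv ℝ f w (Pi.single i 1, 0)

/-- `δf/δΣ`, the gradient for the pairing `tr(ξ η)` of a function of `(z, Σ)`. -/
def dSigma {d : ℕ} (f : Moments d → ℝ) (w : Moments d) : Sym2 d :=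
  symGrad ((fderiv ℝ f w).toLinearMap ∘ₗ LinearMap.inr ℝ (PhaseSpace d) (Sym2 d))

/-- The symmetric matrix `B X B`. -/
def sandwich {n : Type} [Fintype n] (B X : Sym n) : Sym n :=
  ⟨B.1 * X.1 * B.1, by
    change (B.1 * X.1 * B.1)ᵀ = _
    simp only [transpose_mul, Sym.transpose_eq, Matrix.mul_assoc]⟩

theorem JJ_transpose_mul (d : ℕ) : (JJ d)ᵀ * JJ d = 1 := by
  rw [JJ_eq]; simp [Matrix.J_squared]

theorem inv_sandwich {d : ℕ} {B : Sym (Fin d)} (hB : B.1.PosDef) (X : Sym (Fin d)) :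
    (B.1)⁻¹ * (sandwich B X).1 * (B.1)⁻¹ = X.1 := by
  have hd : IsUnit (B.1).det := (Matrix.isUnit_iff_isUnit_det _).1 hB.isUnit
  rw [sandwich, ← Matrix.mul_assoc, ← Matrix.mul_assoc, nonsing_inv_mul _ hd, Matrix.one_mul,
    mul_nonsing_inv_cancel_right _ _ hd]

theorem Omega_sub {d : ℕ} (ħ : ℝ) (x u u' v : PModel d) :
    Omega ħ x (u - u') v = Omega ħ x u v - Omega ħ x u' v := by
  simp only [Omega, OmegaR, OmegaH, Prod.fst_sub, Prod.snd_sub, sub_dotProduct,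
    Submodule.coe_sub, Matrix.mul_sub, Matrix.sub_mul, trace_sub]
  ring

theorem eq_zero_of_trace_mul_self {n : Type} [Fintype n] (A : Sym n)
    (hA : trace (A.1 * A.1) = 0) : A = 0 := by
  apply Subtype.ext
  apply trace_conjTranspose_mul_self_eq_zero_iff.1
  rwa [conjTranspose_eq_transpose_of_trivial, Sym.transpose_eq]

theorem eq_zero_of_Omega {d : ℕ} {ħ : ℝ} (hħ : ħ ≠ 0) {x : PModel d} (hx : x ∈ P d)
    {X : PModel d} (hX : ∀ v, Omega ħ x X v = 0) : X = 0 := by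
  have h4 : ħ / 4 ≠ 0 := by positivity
  have hB : (x.2.2.1).PosDef := hx
  have h1 := hX ((JJ d)ᵀ *ᵥ X.1, 0)
  have h2 := hX (0, (sandwich x.2.2 X.2.2, 0))
  have h3 := hX (0, (0, sandwich x.2.2 X.2.1))
  have hJ : JJ d * (JJ d)ᵀ = 1 := by
    rw [JJ_eq]; simp [Matrix.J_squared]
  simp only [Omega, OmegaR, OmegaH, mulVec_mulVec, hJ, one_mulVec, Prod.fst_zero,
    Prod.snd_zero, ZeroMemClass.coe_zero, Matrix.zero_mul, trace_zero,
    sub_zero, mul_zero, mulVec_zero, dotProduct_zero, zero_sub, inv_sandwich hB] at h1 h2 h3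
  have e2 : trace (X.2.2.1 * X.2.2.1) = 0 := by
    have : trace ((x.2.2.1)⁻¹ * X.2.2.1 * (x.2.2.1)⁻¹ * (sandwich x.2.2 X.2.2).1) =
        trace (X.2.2.1 * X.2.2.1) := by
      rw [Matrix.mul_assoc, Matrix.mul_assoc, trace_mul_comm, Matrix.mul_assoc, Matrix.mul_assoc,
        ← Matrix.mul_assoc ((x.2.2.1)⁻¹), inv_sandwich hB]
    rw [this] at h2
    simpa [h4, hħ] using h2
  have e3 : trace (X.2.1.1 * X.2.1.1) = 0 := by simpa [h4, hħ] using h3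
  refine Prod.ext (dotProduct_self_eq_zero.1 h1) (Prod.ext ?_ ?_)
  · exact eq_zero_of_trace_mul_self _ e3
  · exact eq_zero_of_trace_mul_self _ e2

/-- There is exactly one Hamiltonian vector for each differential. -/
theorem existsUnique_hamVec {d : ℕ} {ħ : ℝ} (hħ : ħ ≠ 0) {x : PModel d} (hx : x ∈ P d)
    (ℓ : PModel d →L[ℝ] ℝ) : ∃! X, ∀ v, Omega ħ x X v = ℓ v := by
  have hB : (x.2.2.1).PosDef := hx
  let g : PhaseSpace d := fun i => ℓ (Pi.single i 1, 0)
  let gA : Sym (Fin d) := symGrad (ℓ.toLinearMap ∘ₗ LinearMap.inr ℝ _ _ ∘ₗ LinearMap.inl ℝ _ _)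
  let gB : Sym (Fin d) := symGrad (ℓ.toLinearMap ∘ₗ LinearMap.inr ℝ _ _ ∘ₗ LinearMap.inr ℝ _ _)
  have hex : ∀ v, Omega ħ x
      (JJ d *ᵥ g, ((4 / ħ) • sandwich x.2.2 gB, -((4 / ħ) • sandwich x.2.2 gA))) v = ℓ v := by
    intro v
    have hv : v = (v.1, 0) + ((0, (v.2.1, 0)) + (0, (0, v.2.2))) := by
      ext <;> simp
    have e1 : ℓ (v.1, 0) = g ⬝ᵥ v.1 := by
      have hs : (v.1, (0 : SiegelModel d)) =
          ∑ i, v.1 i • ((Pi.single i 1, 0) : PModel d) := by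
        refine Prod.ext ?_ ?_
        · rw [Prod.fst_sum]
          ext j
          simp [Finset.sum_apply, Pi.single_apply]
        · rw [Prod.snd_sum]
          simp
      rw [hs, map_sum]
      simp only [map_smul, smul_eq_mul, dotProduct, g]
      exact Finset.sum_congr rfl fun i _ => mul_comm _ _
    have e2 : ℓ (0, (v.2.1, 0)) = trace (gA.1 * v.2.1.1) :=
      (trace_symGrad_mul (ℓ.toLinearMap ∘ₗ LinearMap.inr ℝ (PhaseSpace d) (SiegelModel d) ∘ₗ
        LinearMap.inl ℝ (Sym (Fin d)) (Sym (Fin d))) v.2.1).symm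
    have e3 : ℓ (0, (0, v.2.2)) = trace (gB.1 * v.2.2.1) :=
      (trace_symGrad_mul (ℓ.toLinearMap ∘ₗ LinearMap.inr ℝ (PhaseSpace d) (SiegelModel d) ∘ₗ
        LinearMap.inr ℝ (Sym (Fin d)) (Sym (Fin d))) v.2.2).symm
    have e4 : trace ((x.2.2.1)⁻¹ * v.2.2.1 * (x.2.2.1)⁻¹ * (sandwich x.2.2 gB).1) =
        trace (gB.1 * v.2.2.1) := by
      rw [Matrix.mul_assoc, Matrix.mul_assoc, trace_mul_comm, Matrix.mul_assoc, Matrix.mul_assoc,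
        ← Matrix.mul_assoc ((x.2.2.1)⁻¹), inv_sandwich hB, trace_mul_comm]
    have e5 : (JJ d *ᵥ g) ⬝ᵥ (JJ d *ᵥ v.1) = g ⬝ᵥ v.1 := by
      rw [dotProduct_mulVec, ← mulVec_transpose, mulVec_mulVec, JJ_transpose_mul, one_mulVec]
    conv_rhs => rw [hv, map_add, map_add, e1, e2, e3]
    simp only [Omega, OmegaR, OmegaH, e5, Submodule.coe_neg, Submodule.coe_smul, Matrix.mul_neg,
      Matrix.neg_mul, Matrix.mul_smul, Matrix.smul_mul, trace_neg, trace_smul, inv_sandwich hB,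
      e4, smul_eq_mul]
    field_simp
    ring
  refine ⟨_, hex, fun Y hY => ?_⟩
  rw [← sub_eq_zero]
  refine eq_zero_of_Omega hħ hx fun v => ?_
  rw [Omega_sub, hY, hex, sub_self]

/-! ### The Lie algebra `sym(2d, ℝ)`, coadjoint orbits, the moment bracket -/

/-- `[ξ, η]_sym = ξ 𝕁ᵀ η - η 𝕁ᵀ ξ`. -/
def symBracket {d : ℕ} (ξ η : Sym2 d) : Sym2 d :=
  ⟨ξ.1 * (JJ d)ᵀ * η.1 - η.1 * (JJ d)ᵀ * ξ.1, by
    change (ξ.1 * (JJ d)ᵀ * η.1 - η.1 * (JJ d)ᵀ * ξ.1)ᵀ = _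
    simp only [transpose_sub, transpose_mul, Sym.transpose_eq, JJ_transpose, Matrix.mul_neg,
      Matrix.neg_mul, transpose_neg, Matrix.mul_assoc]
    abel⟩

/-- `ad*_ξ μ = 𝕁 ξ μ - μ ξ 𝕁`. -/
def adStar {d : ℕ} (ξ μ : Sym2 d) : Sym2 d :=
  ⟨JJ d * ξ.1 * μ.1 - μ.1 * ξ.1 * JJ d, by
    change (JJ d * ξ.1 * μ.1 - μ.1 * ξ.1 * JJ d)ᵀ = _
    simp only [transpose_sub, transpose_mul, Sym.transpose_eq, JJ_transpose, Matrix.mul_neg,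
      Matrix.neg_mul, Matrix.mul_assoc]
    abel⟩

/-- The coadjoint action `Ad*_{S⁻¹} μ = S μ Sᵀ`. -/
def coAd {d : ℕ} (S : Matrix.symplecticGroup (Fin d) ℝ) (μ : Sym2 d) : Sym2 d :=
  ⟨S.1 * μ.1 * S.1ᵀ, by
    change (S.1 * μ.1 * S.1ᵀ)ᵀ = _
    simp only [transpose_mul, transpose_transpose, Sym.transpose_eq, Matrix.mul_assoc]⟩

/-- The coadjoint orbit through `μ`. -/
def coadjointOrbit {d : ℕ} (μ : Sym2 d) : Set (Sym2 d) := Set.range fun S => coAd S μ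

/-- The tangent space `{ad*_ξ μ}` at `μ` of the coadjoint orbit through `μ`. -/
def orbitTangent {d : ℕ} (μ : Sym2 d) : Set (Sym2 d) := Set.range fun ξ => adStar ξ μ

/-- The `(+)`-Kirillov–Kostant–Souriau form: `Ω_𝒪⁺(μ)(ad*_ξ μ, ad*_η μ) = tr(μ [ξ, η]_sym)`.
It is independent of the choice of `ξ` and `η`, see `kks_adStar`. -/
def kks {d : ℕ} (μ u v : Sym2 d) : ℝ :=
  trace (μ.1 * (symBracket (Classical.epsilon fun ξ => adStar ξ μ = u)
    (Classical.epsilon fun η => adStar η μ = v)).1)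

theorem trace_mul_symBracket {d : ℕ} (μ ξ η : Sym2 d) :
    trace (μ.1 * (symBracket ξ η).1) = trace ((adStar ξ μ).1 * η.1) := by
  have h1 : trace (μ.1 * (η.1 * (JJ d * ξ.1))) = trace (JJ d * (ξ.1 * (μ.1 * η.1))) := by
    rw [← Matrix.mul_assoc, trace_mul_comm, Matrix.mul_assoc]
  simp only [symBracket, adStar, JJ_transpose, Matrix.mul_sub, Matrix.sub_mul, Matrix.mul_neg,
    Matrix.neg_mul, trace_sub, trace_neg, Matrix.mul_assoc, h1]
  ring

theorem trace_mul_symBracket' {d : ℕ} (μ ξ η : Sym2 d) :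
    trace (μ.1 * (symBracket ξ η).1) = -trace ((adStar η μ).1 * ξ.1) := by
  rw [← trace_mul_symBracket, ← trace_neg, ← Matrix.mul_neg]
  congr 2
  simp only [symBracket, neg_sub]

theorem kks_adStar {d : ℕ} (μ ξ η : Sym2 d) :
    kks μ (adStar ξ μ) (adStar η μ) = trace (μ.1 * (symBracket ξ η).1) := by
  have h1 := Classical.epsilon_spec (p := fun ζ => adStar ζ μ = adStar ξ μ) ⟨ξ, rfl⟩
  have h2 := Classical.epsilon_spec (p := fun ζ => adStar ζ μ = adStar η μ) ⟨η, rfl⟩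
  rw [kks, trace_mul_symBracket, h1, ← trace_mul_symBracket, trace_mul_symBracket', h2,
    ← trace_mul_symBracket']

/-- The form `ω = Ω_{ℝ^{2d}} - (ħ/4) Ω_𝒪⁺` on `ℝ^{2d} × 𝒪`, at the point `w = (z, Σ)`, for
tangent vectors `u`, `v` in `ℝ^{2d} × T_Σ 𝒪`. -/
def omega {d : ℕ} (ħ : ℝ) (w u v : Moments d) : ℝ :=
  OmegaR u.1 v.1 - ħ / 4 * kks w.2 u.2 v.2

/-- `ℝ^{2d} × T_Σ 𝒪`, the tangent space of `ℝ^{2d} × 𝒪` at `w = (z, Σ)`. -/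
def momentTangent {d : ℕ} (w : Moments d) : Set (Moments d) := {u | u.2 ∈ orbitTangent w.2}

/-- The canonical bracket in `z = (q, p)`, with `Σ` fixed. -/
def poissonR {d : ℕ} (f g : Moments d → ℝ) (w : Moments d) : ℝ :=
  ∑ i : Fin d, (dz f w (Sum.inl i) * dz g w (Sum.inr i) - dz g w (Sum.inl i) * dz f w (Sum.inr i))

/-- The bracket `{f, g}(z, Σ) = {f, g}_{ℝ^{2d}} - (4/ħ) tr(Σ [δf/δΣ, δg/δΣ]_sym)` of the
Gaussian moments. -/
def poissonMoments {d : ℕ} (ħ : ℝ) (f g : Moments d → ℝ) (w : Moments d) : ℝ :=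
  poissonR f g w - 4 / ħ * trace (w.2.1 * (symBracket (dSigma f w) (dSigma g w)).1)

/-! ### The map `M` and the notion of a momentum map -/

/-- The covariance matrix `σ(𝒞)`. -/
def sigma {d : ℕ} (c : SiegelModel d) : Sym2 d :=
  ⟨fromBlocks (c.2.1)⁻¹ ((c.2.1)⁻¹ * c.1.1) (c.1.1 * (c.2.1)⁻¹)
      (c.1.1 * (c.2.1)⁻¹ * c.1.1 + c.2.1), by
    change (fromBlocks (c.2.1)⁻¹ ((c.2.1)⁻¹ * c.1.1) (c.1.1 * (c.2.1)⁻¹)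
      (c.1.1 * (c.2.1)⁻¹ * c.1.1 + c.2.1))ᵀ = _
    simp only [fromBlocks_transpose, transpose_mul, transpose_add, transpose_nonsing_inv,
      Sym.transpose_eq, Matrix.mul_assoc]⟩

/-- `M(z, 𝒞) = (z, σ(𝒞))`. -/
def M {d : ℕ} (x : PModel d) : Moments d := (x.1, sigma x.2)

/-- The pairing of `ℝ^{2d} × sym(2d, ℝ)` with the Lie algebra of `G` by which it is identified
with the dual of that Lie algebra. The factor `-ħ/4` is that of the form `Ω`. -/
def pairing {d : ℕ} (ħ : ℝ) (w : Moments d) (a : PhaseSpace d × Sym2 d) : ℝ :=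
  w.1 ⬝ᵥ a.1 - ħ / 4 * trace (w.2.1 * a.2.1)

/-- `K : 𝒫 → ℝ^{2d} × sym(2d, ℝ)` is a momentum map of the action `Ψ` on `(𝒫, Ω)`: it is smooth
and `Ω(a_𝒫, ·) = d⟨K, a⟩` for every `a` in the Lie algebra of `G`. -/
def IsMomentumMap {d : ℕ} (ħ : ℝ) (K : PModel d → Moments d) : Prop :=
  ContDiffOn ℝ ∞ K (P d) ∧
    ∀ (a : PhaseSpace d × Sym2 d) (x : P d) (v : PModel d),
      Omega ħ x.1 (infGen a x) v = fderiv ℝ (fun y => pairing ħ (K y) a) x.1 v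

/-- The action `(δz, S) · (z, Σ) = (z + 𝕁 δz, Ad*_{S⁻¹} Σ)` of `G` on `ℝ^{2d} × sym(2d, ℝ)`.
The coadjoint action of `G` is `(z, Σ) ↦ (z, Ad*_{S⁻¹} Σ)`, because `ℝ^{2d}` is abelian; this is
the affine action with that linear part whose orbits are the sets `ℝ^{2d} × 𝒪`. -/
def momentAct {d : ℕ} (g : G d) (w : Moments d) : Moments d :=
  (w.1 + JJ d *ᵥ g.1.toAdd, coAd g.2 w.2)

/-! ### Hamiltonians -/

/-- `H_cl(q, p) = p²/(2m) + V(q)`. -/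
def Hcl {d : ℕ} (m : ℝ) (V : (Fin d → ℝ) → ℝ) (z : PhaseSpace d) : ℝ :=
  (z ∘ Sum.inr) ⬝ᵥ (z ∘ Sum.inr) / (2 * m) + V (z ∘ Sum.inl)

/-- The Hamiltonian `H = p²/(2m) + V + (ħ/4) tr[ℬ⁻¹((𝒜² + ℬ²)/m + D²V)]` on `𝒫`. -/
def H {d : ℕ} (ħ m : ℝ) (V : (Fin d → ℝ) → ℝ) (x : PModel d) : ℝ :=
  (x.1 ∘ Sum.inr) ⬝ᵥ (x.1 ∘ Sum.inr) / (2 * m) + V (x.1 ∘ Sum.inl) +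
    ħ / 4 * trace ((x.2.2.1)⁻¹ *
      ((1 / m) • (x.2.1.1 ^ 2 + x.2.2.1 ^ 2) + hessian V (x.1 ∘ Sum.inl)))

/-- The Hamiltonian `h = p²/(2m) + V + (ħ/4) tr(Σ₂₂/m + Σ₁₁ D²V)` on `ℝ^{2d} × sym(2d, ℝ)`. -/
def h {d : ℕ} (ħ m : ℝ) (V : (Fin d → ℝ) → ℝ) (w : Moments d) : ℝ :=
  (w.1 ∘ Sum.inr) ⬝ᵥ (w.1 ∘ Sum.inr) / (2 * m) + V (w.1 ∘ Sum.inl) +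
    ħ / 4 * trace ((1 / m) • w.2.1.toBlocks₂₂ + w.2.1.toBlocks₁₁ * hessian V (w.1 ∘ Sum.inl))

/-- `X` is the Hamiltonian vector of `f` at a point `w` of `ℝ^{2d} × 𝒪`: it is tangent and
`ω(X, v) = df(v)` for all tangent `v`. -/
def IsHamVecMoments {d : ℕ} (ħ : ℝ) (f : Moments d → ℝ) (w X : Moments d) : Prop :=
  X ∈ momentTangent w ∧ ∀ v ∈ momentTangent w, omega ħ w X v = fderiv ℝ f w v

end GWP

end

/-!
The columns of the frame `F`, with the blocks `I` and `𝒞`, span the Lagrangian subspace that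
corresponds to `𝒞 ∈ ℍ_d`, and `F ℬ⁻¹ F* = σ(𝒞) - i𝕁`. A symplectic matrix carries frames to frames
up to a change of basis, `S F(𝒞) = F(Φ_S(𝒞)) (S₁₁ + S₁₂ 𝒞)`, and this makes `Φ` an action and `σ`
equivariant. The generator of `ξ` on `ℍ_d` is `Fᵀ ξ F`, and `dσ(V) = Im (F ℬ⁻¹ V̄ ℬ⁻¹ Fᵀ)`, so the
cyclicity of the trace gives `Ω_ℍ(Fᵀ ξ F, V) = tr(ξ dσ(V))`, which is the momentum map identity.

Every tangent vector of `ℍ_d` is a generator, and `dσ` carries generators to coadjoint vectors;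
hence `σ` pulls the orbit form back to `Ω_ℍ`. Moreover `ℬ = R Rᵀ` shows that every `σ(𝒞)` is in the
coadjoint orbit of `I = σ(iI)`, so that the image of `σ` is one orbit. A function `f ∘ M` then has a
Hamiltonian field that `M` pushes forward to that of `f`, and the semiclassical Hamiltonian is of
this form, `H = h ∘ M`.
-/

noncomputable section

namespace GWP

variable {d : ℕ}

theorem hasDerivAt_add_smul {E : Type*} [NormedAddCommGroup E] [NormedSpace ℝ E] (x v : E) :
    HasDerivAt (fun t : ℝ => x + t • v) v 0 := by
  have h := ((hasDerivAt_id (0 : ℝ)).smul_const v).const_add x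
  rwa [one_smul] at h

section MatrixCalculus

variable {k l m n : Type} {E : Type*} [NormedAddCommGroup E] [NormedSpace ℝ E]
  {r : WithTop ℕ∞}

theorem hasDerivAt_matrix [Finite n] {f : ℝ → Matrix l n ℝ} {f' : Matrix l n ℝ} {t : ℝ} :
    HasDerivAt f f' t ↔ ∀ i j, HasDerivAt (fun s => f s i j) (f' i j) t := by
  cases nonempty_fintype n
  exact (hasDerivAt_pi (φ := f) (φ' := f')).trans (forall_congr' fun _ => hasDerivAt_pi)

theorem contDiffAt_matrix [Fintype l] [Fintype n] {f : E → Matrix l n ℝ} {x : E} :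
    ContDiffAt ℝ r f x ↔ ∀ i j, ContDiffAt ℝ r (fun y => f y i j) x :=
  (contDiffAt_pi (Φ := f)).trans (forall_congr' fun _ => contDiffAt_pi)

theorem hasDerivAt_matrix_transpose [Finite l] [Finite n] {f : ℝ → Matrix l n ℝ}
    {f' : Matrix l n ℝ} {t : ℝ} (hf : HasDerivAt f f' t) :
    HasDerivAt (fun s => (f s)ᵀ) f'ᵀ t := by
  rw [hasDerivAt_matrix] at *
  exact fun i j => hf j i

theorem hasDerivAt_fromBlocks [Finite k] [Finite n] {A : ℝ → Matrix l k ℝ}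
    {B : ℝ → Matrix l n ℝ} {C : ℝ → Matrix m k ℝ} {D : ℝ → Matrix m n ℝ}
    {A' : Matrix l k ℝ} {B' : Matrix l n ℝ} {C' : Matrix m k ℝ} {D' : Matrix m n ℝ} {t : ℝ}
    (hA : HasDerivAt A A' t) (hB : HasDerivAt B B' t) (hC : HasDerivAt C C' t)
    (hD : HasDerivAt D D' t) :
    HasDerivAt (fun s => fromBlocks (A s) (B s) (C s) (D s)) (fromBlocks A' B' C' D') t := by
  rw [hasDerivAt_matrix] at *
  rintro (i | i) (j | j)
  exacts [hA i j, hB i j, hC i j, hD i j]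

theorem hasDerivAt_matrix_mul [Finite k] [Fintype n] {f : ℝ → Matrix l n ℝ} {g : ℝ → Matrix n k ℝ}
    {f' : Matrix l n ℝ} {g' : Matrix n k ℝ} {t : ℝ} (hf : HasDerivAt f f' t)
    (hg : HasDerivAt g g' t) : HasDerivAt (fun s => f s * g s) (f' * g t + f t * g') t := by
  rw [hasDerivAt_matrix] at *
  intro i j
  simp only [Matrix.mul_apply, Matrix.add_apply, ← Finset.sum_add_distrib]
  exact HasDerivAt.fun_sum fun a _ => (hf i a).mul (hg a j)

theorem contDiffAt_fromBlocks [Fintype k] [Fintype l] [Fintype m] [Fintype n]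
    {A : E → Matrix l k ℝ} {B : E → Matrix l n ℝ} {C : E → Matrix m k ℝ}
    {D : E → Matrix m n ℝ} {x : E} (hA : ContDiffAt ℝ r A x) (hB : ContDiffAt ℝ r B x)
    (hC : ContDiffAt ℝ r C x) (hD : ContDiffAt ℝ r D x) :
    ContDiffAt ℝ r (fun y => fromBlocks (A y) (B y) (C y) (D y)) x := by
  rw [contDiffAt_matrix] at *
  rintro (i | i) (j | j)
  exacts [hA i j, hB i j, hC i j, hD i j]

theorem contDiffAt_matrix_mul [Fintype l] [Fintype n] [Fintype k] {f : E → Matrix l n ℝ}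
    {g : E → Matrix n k ℝ} {x : E} (hf : ContDiffAt ℝ r f x) (hg : ContDiffAt ℝ r g x) :
    ContDiffAt ℝ r (fun y => f y * g y) x := by
  rw [contDiffAt_matrix] at *
  intro i j
  simp only [Matrix.mul_apply]
  exact ContDiffAt.sum fun a _ => (hf i a).mul (hg a j)

theorem map_ringInverse {R S F : Type*} [MonoidWithZero R] [MonoidWithZero S] [EquivLike F R S]
    [MulEquivClass F R S] (e : F) (a : R) : e (Ring.inverse a) = Ring.inverse (e a) := by
  by_cases ha : IsUnit a
  · obtain ⟨u, rfl⟩ := ha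
    rw [Ring.inverse_unit]
    exact (Ring.inverse_unit (Units.map (e : R →* S) u)).symm
  · rw [Ring.inverse_non_unit _ ha, Ring.inverse_non_unit _ (by rwa [MulEquiv.isUnit_map]),
      map_zero]

variable [Fintype n] [DecidableEq n]

theorem contDiffAt_matrix_inv {f : E → Matrix n n ℝ} {x : E} (hf : ContDiffAt ℝ r f x)
    (hx : IsUnit (f x)) : ContDiffAt ℝ r (fun y => (f y)⁻¹) x := by
  -- Inversion is smooth in a complete normed algebra, such as that of the operators on `ℝⁿ`.
  let e : Matrix n n ℝ ≃L[ℝ] (EuclideanSpace ℝ n →L[ℝ] EuclideanSpace ℝ n) :=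
    (toEuclideanCLM (n := n) (𝕜 := ℝ)).toAlgEquiv.toLinearEquiv.toContinuousLinearEquiv
  have h_inv (A : Matrix n n ℝ) : A⁻¹ = e.symm (Ring.inverse (e A)) := by
    rw [nonsing_inv_eq_ringInverse, ContinuousLinearEquiv.eq_symm_apply]
    exact map_ringInverse (toEuclideanCLM (n := n) (𝕜 := ℝ)) A
  obtain ⟨u, hu⟩ : IsUnit (e (f x)) := hx.map (toEuclideanCLM (𝕜 := ℝ))
  have h_smooth : ContDiffAt ℝ r Ring.inverse (e (f x)) := hu ▸ contDiffAt_ringInverse ℝ u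
  have h_comp : ContDiffAt ℝ r (Ring.inverse ∘ fun y => e (f y)) x :=
    h_smooth.comp x (e.contDiff.contDiffAt.comp x hf)
  simp only [h_inv]
  exact (e.symm.contDiff.contDiffAt.comp x h_comp :)

theorem hasDerivAt_matrix_inv {f : ℝ → Matrix n n ℝ} {f' : Matrix n n ℝ} {t : ℝ}
    (hf : HasDerivAt f f' t) (ht : IsUnit (f t)) :
    HasDerivAt (fun s => (f s)⁻¹) (-((f t)⁻¹ * f' * (f t)⁻¹)) t := by
  let _ := Matrix.linftyOpNormedRing (n := n) (α := ℝ)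
  let _ := Matrix.linftyOpNormedAlgebra (R := ℝ) (n := n) (α := ℝ)
  have : @CompleteSpace (Matrix n n ℝ)
      Matrix.linftyOpNormedRing.toPseudoMetricSpace.toUniformSpace :=
    FiniteDimensional.complete ℝ (Matrix n n ℝ)
  obtain ⟨u, hu⟩ := ht
  have h := (hasFDerivAt_ringInverse (𝕜 := ℝ) u).comp_hasDerivAt_of_eq t hf hu
  simp only [nonsing_inv_eq_ringInverse, ← hu, Ring.inverse_unit]
  exact h

theorem hasDerivAt_exp_smul_matrix (A : Matrix n n ℝ) :
    HasDerivAt (fun t : ℝ => NormedSpace.exp (t • A)) A 0 := by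
  let _ := Matrix.linftyOpNormedRing (n := n) (α := ℝ)
  let _ := Matrix.linftyOpNormedAlgebra (R := ℝ) (n := n) (α := ℝ)
  have : @CompleteSpace (Matrix n n ℝ)
      Matrix.linftyOpNormedRing.toPseudoMetricSpace.toUniformSpace :=
    FiniteDimensional.complete ℝ (Matrix n n ℝ)
  have h := hasDerivAt_exp_smul_const (𝕂 := ℝ) A 0
  rw [zero_smul, NormedSpace.exp_zero, one_mul] at h
  exact h

end MatrixCalculus

section SymmetricMatrices

theorem convex_posDef {n : Type} : Convex ℝ {A : Sym n | (A : Matrix n n ℝ).PosDef} := by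
  refine convex_iff_forall_pos.2 fun A hA B hB a b ha hb _ => ?_
  exact (PosDef.smul hA ha).add (PosDef.smul hB hb)

theorem isOpen_posDef {n : Type} [Finite n] : IsOpen {A : Sym n | (A : Matrix n n ℝ).PosDef} := by
  classical
  cases nonempty_fintype n
  rw [isOpen_iff_mem_nhds]
  intro A hA
  have h_cont : Continuous fun y : Sym n × (n → ℝ) => y.2 ⬝ᵥ (y.1.1 *ᵥ y.2) :=
    Continuous.dotProduct continuous_snd
      ((continuous_subtype_val.comp continuous_fst).matrix_mulVec continuous_snd)
  have h_sphere : ∀ᶠ B in nhds A, ∀ v ∈ Metric.sphere (0 : n → ℝ) 1, 0 < v ⬝ᵥ (B.1 *ᵥ v) := by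
    refine (isCompact_sphere (0 : n → ℝ) 1).eventually_forall_of_forall_eventually fun v hv => ?_
    have hv0 : v ≠ 0 := ne_zero_of_mem_unit_sphere ⟨v, hv⟩
    have hpos : 0 < v ⬝ᵥ (A.1 *ᵥ v) := by simpa using Matrix.PosDef.dotProduct_mulVec_pos hA hv0
    exact h_cont.continuousAt.eventually (lt_mem_nhds hpos)
  filter_upwards [h_sphere] with B hB
  refine PosDef.of_dotProduct_mulVec_pos ?_ fun {v} hv => ?_
  · rw [IsHermitian, conjTranspose_eq_transpose_of_trivial, Sym.transpose_eq]
  · have h := hB (‖v‖⁻¹ • v) (by simp [norm_smul, hv])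
    rw [mulVec_smul, dotProduct_smul, smul_dotProduct, smul_eq_mul, smul_eq_mul, ← mul_assoc] at h
    simpa using pos_of_mul_pos_right h (by positivity)

variable {n : Type} [Fintype n] {E : Type*} [NormedAddCommGroup E] [NormedSpace ℝ E]
  {r : WithTop ℕ∞}

/-- The projection `A ↦ (A + Aᵀ) / 2` of the square matrices onto the symmetric ones. It turns
differentiability of maps into `Sym n` into differentiability of matrix-valued maps. -/
def symProj : Matrix n n ℝ →L[ℝ] Sym n :=
  LinearMap.toContinuousLinearMap <| LinearMap.codRestrict (symSubmodule n)
    ((1 / 2 : ℝ) • (LinearMap.id + (transposeLinearEquiv n n ℝ ℝ).toLinearMap)) fun A => by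
      change ((1 / 2 : ℝ) • (A + Aᵀ))ᵀ = (1 / 2 : ℝ) • (A + Aᵀ)
      rw [transpose_smul, transpose_add, transpose_transpose, add_comm]

theorem symProj_coe (A : Sym n) : symProj (A : Matrix n n ℝ) = A := by
  apply Subtype.ext
  change (1 / 2 : ℝ) • (A.1 + A.1ᵀ) = A.1
  rw [Sym.transpose_eq, ← two_smul ℝ, smul_smul]
  norm_num

theorem hasDerivAt_sym {n : Type} [Finite n] {f : ℝ → Sym n} {f' : Sym n} {t : ℝ} :
    HasDerivAt f f' t ↔ HasDerivAt (fun s => (f s : Matrix n n ℝ)) (f' : Matrix n n ℝ) t := by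
  cases nonempty_fintype n
  refine ⟨fun h => ((symSubmodule n).subtypeL.hasFDerivAt.comp_hasDerivAt t h :), fun h => ?_⟩
  have h_proj := (symProj (n := n)).hasFDerivAt.comp_hasDerivAt t h
  exact (h_proj.congr_deriv (symProj_coe f')).congr_of_eventuallyEq
    (.of_forall fun s => (symProj_coe (f s)).symm)

theorem contDiffAt_sym {f : E → Sym n} {x : E} :
    ContDiffAt ℝ r f x ↔ ContDiffAt ℝ r (fun y => (f y : Matrix n n ℝ)) x := by
  refine ⟨fun h => ((symSubmodule n).subtypeL.contDiff.contDiffAt.comp x h :), fun h => ?_⟩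
  have h_proj := (symProj (n := n)).contDiff.contDiffAt.comp x h
  exact h_proj.congr_of_eventuallyEq (.of_forall fun y => (symProj_coe (f y)).symm)

end SymmetricMatrices

theorem isOpen_P : IsOpen (P d) :=
  isOpen_posDef.preimage (continuous_snd.comp continuous_snd)

theorem convex_P : Convex ℝ (P d) :=
  convex_posDef.linear_preimage (LinearMap.snd ℝ _ _ ∘ₗ LinearMap.snd ℝ _ _)

theorem isUnit_of_mem_siegel {c : SiegelModel d} (hc : c ∈ siegel d) : IsUnit c.2.1 :=
  Matrix.PosDef.isUnit hc

section ComplexMatrices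

open Complex

variable {l m n : Type*}

theorem map_ofReal_mul [Fintype m] (A : Matrix l m ℝ) (B : Matrix m n ℝ) :
    (A * B).map ofReal = A.map ofReal * B.map ofReal :=
  Matrix.map_mul (f := ofRealHom)

theorem map_ofReal_one [DecidableEq n] : (1 : Matrix n n ℝ).map ofReal = 1 :=
  Matrix.map_one _ ofReal_zero ofReal_one

theorem map_ofReal_inv [Fintype n] [DecidableEq n] {A : Matrix n n ℝ} (hA : IsUnit A) :
    A⁻¹.map ofReal = (A.map ofReal)⁻¹ := by
  refine (inv_eq_right_inv ?_).symm
  rw [← map_ofReal_mul, mul_nonsing_inv _ ((isUnit_iff_isUnit_det A).1 hA), map_ofReal_one]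

theorem conjTranspose_map_ofReal (A : Matrix m n ℝ) : (A.map ofReal)ᴴ = Aᵀ.map ofReal := by
  ext i j
  simp

theorem map_im_ofReal_add (X Y : Matrix m n ℝ) :
    (X.map ofReal + I • Y.map ofReal).map im = Y := by
  ext i j
  simp

theorem map_re_ofReal_sub (X Y : Matrix m n ℝ) :
    (X.map ofReal - I • Y.map ofReal).map re = X := by
  ext i j
  simp

theorem map_im_ofReal_mul [Fintype m] (A : Matrix l m ℝ) (Z : Matrix m n ℂ) :
    (A.map ofReal * Z).map im = A * Z.map im := by
  ext i j
  simp [Matrix.mul_apply]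

theorem im_trace [Fintype n] (Z : Matrix n n ℂ) : (trace Z).im = trace (Z.map im) :=
  im_sum _ _

theorem map_ofReal_add_mul_map_ofReal_add [Fintype m] (X Y : Matrix l m ℝ) (A B : Matrix m n ℝ) :
    (X.map ofReal + I • Y.map ofReal) * (A.map ofReal + I • B.map ofReal) =
      (X * A - Y * B).map ofReal + I • (X * B + Y * A).map ofReal := by
  rw [Matrix.map_add _ ofReal_add, Matrix.map_sub _ ofReal_sub]
  simp only [map_ofReal_mul, Matrix.mul_add, Matrix.add_mul, Matrix.smul_mul, Matrix.mul_smul,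
    smul_add, smul_smul, I_mul_I]
  module

theorem map_re_add_map_im (Z : Matrix m n ℂ) :
    (Z.map re).map ofReal + I • (Z.map im).map ofReal = Z := by
  ext i j
  simp only [Matrix.add_apply, Matrix.smul_apply, map_apply, smul_eq_mul]
  rw [mul_comm, re_add_im]

end ComplexMatrices

section Frame

open Complex

theorem toComplex_injective : Function.Injective (toComplex (d := d)) := by
  intro c c' h
  refine Prod.ext (Subtype.ext ?_) (Subtype.ext ?_) <;> ext i j
  · simpa [toComplex] using congrArg re (congrFun (congrFun h i) j)
  · simpa [toComplex] using congrArg im (congrFun (congrFun h i) j)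

theorem toComplex_conjTranspose_transpose (c : SiegelModel d) :
    (toComplex c)ᴴᵀ = (toComplex c)ᴴ := by
  change (toComplex c).map star = (toComplex c)ᵀ.map star
  rw [toComplex_transpose]

theorem toComplex_Phi (S : symplecticGroup (Fin d) ℝ) (c : siegel d) :
    toComplex (Phi S c).1 = mobius S.1 c.1 :=
  map_re_add_map_im _

/-- The matrix `F` with the blocks `I` and `𝒞`: its columns span the Lagrangian subspace of
`ℂ^{2d}` that corresponds to `𝒞`. -/
def frame (c : SiegelModel d) : Matrix (Fin d ⊕ Fin d) (Fin d) ℂ :=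
  fromRows 1 (toComplex c)

theorem eq_of_frame_mul_eq {c c' : SiegelModel d} {D D' : Matrix (Fin d) (Fin d) ℂ}
    (hD : IsUnit D) (h : frame c * D = frame c' * D') : c = c' := by
  simp only [frame, fromRows_mul, Matrix.one_mul, fromRows_ext_iff] at h
  obtain ⟨rfl, h⟩ := h
  exact toComplex_injective (hD.mul_left_injective h)

theorem frame_mul_conjTranspose {c : SiegelModel d} (hc : c ∈ siegel d) :
    frame c * ((c.2.1)⁻¹).map ofReal * (frame c)ᴴ =
      (sigma c).1.map ofReal - I • (JJ d).map ofReal := by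
  have hu : IsUnit (c.2.1).det := (isUnit_iff_isUnit_det _).1 (isUnit_of_mem_siegel hc)
  have hNB : ((c.2.1)⁻¹).map ofReal * (c.2.1).map ofReal = 1 := by
    rw [← map_ofReal_mul, nonsing_inv_mul _ hu, map_ofReal_one]
  have hBN : (c.2.1).map ofReal * ((c.2.1)⁻¹).map ofReal = 1 := by
    rw [← map_ofReal_mul, mul_nonsing_inv _ hu, map_ofReal_one]
  have hadd (X Y : Matrix (Fin d) (Fin d) ℝ) :
      (X + Y).map ofReal = X.map ofReal + Y.map ofReal := Matrix.map_add _ ofReal_add X Y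
  have hneg : (-1 : Matrix (Fin d) (Fin d) ℝ).map ofReal = -1 := by
    rw [Matrix.map_neg _ ofReal_neg, map_ofReal_one]
  have hzero : (0 : Matrix (Fin d) (Fin d) ℝ).map ofReal = 0 := Matrix.map_zero _ ofReal_zero
  rw [frame, conjTranspose_fromRows_eq_fromCols_conjTranspose, fromRows_mul,
    fromRows_mul_fromCols, toComplex_conjTranspose, sigma, JJ, fromBlocks_map, fromBlocks_map,
    fromBlocks_smul, sub_eq_add_neg (fromBlocks _ _ _ _), fromBlocks_neg, fromBlocks_add, toComplex]
  simp only [conjTranspose_one, Matrix.mul_one, Matrix.one_mul, map_ofReal_mul, map_ofReal_one,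
    hadd, hneg, hzero, smul_zero, neg_zero, add_zero, sub_eq_add_neg, Matrix.add_mul,
    Matrix.mul_add, Matrix.smul_mul, Matrix.mul_smul, Matrix.mul_neg, hNB, hBN,
    Matrix.mul_assoc, smul_add, smul_neg, smul_smul, I_mul_I, neg_smul, one_smul, neg_neg]
  congr 1
  abel

theorem frame_conj_mul_transpose {c : SiegelModel d} (hc : c ∈ siegel d) :
    (frame c)ᴴᵀ * ((c.2.1)⁻¹).map ofReal * (frame c)ᵀ =
      (sigma c).1.map ofReal + I • (JJ d).map ofReal := by
  have h := congrArg transpose (frame_mul_conjTranspose hc)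
  rw [transpose_mul, transpose_mul, transpose_sub, transpose_smul, ← transpose_map,
    ← transpose_map, ← transpose_map, transpose_nonsing_inv, Sym.transpose_eq, Sym.transpose_eq,
    JJ_transpose, Matrix.map_neg _ ofReal_neg, smul_neg, sub_neg_eq_add, ← Matrix.mul_assoc] at h
  exact h

end Frame

section Equivariance

open Complex

theorem map_ofReal_mul_frame (S : Matrix (Fin d ⊕ Fin d) (Fin d ⊕ Fin d) ℝ)
    (c : SiegelModel d) : S.map ofReal * frame c = fromRows (denom S c) (numer S c) := by
  conv_lhs => rw [← fromBlocks_toBlocks S, fromBlocks_map, frame, fromBlocks_mul_fromRows]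
  simp only [Matrix.mul_one, denom, numer]

theorem symplectic_mul_frame (S : symplecticGroup (Fin d) ℝ) (c : siegel d) :
    S.1.map ofReal * frame c.1 = frame (Phi S c).1 * denom S.1 c.1 := by
  have hd := (isUnit_iff_isUnit_det _).1 (denom_isUnit S c.1 c.2)
  rw [map_ofReal_mul_frame, frame, fromRows_mul, toComplex_Phi, mobius, Matrix.one_mul,
    nonsing_inv_mul_cancel_right _ _ hd]

theorem Phi_one (c : siegel d) : Phi 1 c = c := by
  apply Subtype.ext
  refine (eq_of_frame_mul_eq (D := 1) (D' := denom (1 : symplecticGroup (Fin d) ℝ).1 c.1)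
    isUnit_one ?_).symm
  rw [← symplectic_mul_frame, OneMemClass.coe_one, map_ofReal_one, Matrix.one_mul, Matrix.mul_one]

theorem Phi_mul (S S' : symplecticGroup (Fin d) ℝ) (c : siegel d) :
    Phi (S * S') c = Phi S (Phi S' c) := by
  apply Subtype.ext
  refine eq_of_frame_mul_eq (D := denom (S * S').1 c.1)
    (D' := denom S.1 (Phi S' c).1 * denom S'.1 c.1) (denom_isUnit _ _ c.2) ?_
  rw [← symplectic_mul_frame, ← Matrix.mul_assoc, ← symplectic_mul_frame, Matrix.mul_assoc,
    ← symplectic_mul_frame, ← Matrix.mul_assoc, ← map_ofReal_mul, Submonoid.coe_mul]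

theorem Psi_one (x : P d) : Psi 1 x = x := by
  refine Subtype.ext (Prod.ext ?_ (congrArg Subtype.val (Phi_one ⟨x.1.2, x.2⟩)))
  change x.1.1 + JJ d *ᵥ 0 = x.1.1
  rw [mulVec_zero, add_zero]

theorem Psi_mul (g g' : G d) (x : P d) : Psi (g * g') x = Psi g (Psi g' x) := by
  refine Subtype.ext (Prod.ext ?_ (congrArg Subtype.val (Phi_mul g.2 g'.2 ⟨x.1.2, x.2⟩)))
  change x.1.1 + JJ d *ᵥ (g.1.toAdd + g'.1.toAdd) =
    x.1.1 + JJ d *ᵥ g'.1.toAdd + JJ d *ᵥ g.1.toAdd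
  rw [mulVec_add]
  abel

theorem inv_im_Phi (S : symplecticGroup (Fin d) ℝ) (c : siegel d) :
    (((Phi S c).1.2.1)⁻¹).map ofReal =
      denom S.1 c.1 * ((c.1.2.1)⁻¹).map ofReal * (denom S.1 c.1)ᴴ := by
  have hd := (isUnit_iff_isUnit_det _).1 (denom_isUnit S c.1 c.2)
  have h_im : ((Phi S c).1.2.1).map ofReal =
      ((denom S.1 c.1)⁻¹)ᴴ * (c.1.2.1).map ofReal * (denom S.1 c.1)⁻¹ := mobius_im S c.1 c.2
  rw [map_ofReal_inv (isUnit_of_mem_siegel (Phi S c).2), h_im, Matrix.mul_inv_rev,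
    Matrix.mul_inv_rev, nonsing_inv_nonsing_inv _ hd, conjTranspose_nonsing_inv,
    nonsing_inv_nonsing_inv _ (by rw [det_conjTranspose]; exact hd.star),
    map_ofReal_inv (isUnit_of_mem_siegel c.2), Matrix.mul_assoc]

theorem sigma_Phi (S : symplecticGroup (Fin d) ℝ) (c : siegel d) :
    sigma (Phi S c).1 = coAd S (sigma c.1) := by
  have h_complex : (sigma (Phi S c).1).1.map ofReal - I • (JJ d).map ofReal =
      (S.1 * (sigma c.1).1 * S.1ᵀ).map ofReal - I • (S.1 * JJ d * S.1ᵀ).map ofReal :=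
    calc
      _ = frame (Phi S c).1 * (((Phi S c).1.2.1)⁻¹).map ofReal * (frame (Phi S c).1)ᴴ :=
        (frame_mul_conjTranspose (Phi S c).2).symm
      _ = (frame (Phi S c).1 * denom S.1 c.1) * ((c.1.2.1)⁻¹).map ofReal *
            (frame (Phi S c).1 * denom S.1 c.1)ᴴ := by
        simp only [inv_im_Phi, conjTranspose_mul, Matrix.mul_assoc]
      _ = S.1.map ofReal * (frame c.1 * ((c.1.2.1)⁻¹).map ofReal * (frame c.1)ᴴ) *
            (S.1.map ofReal)ᴴ := by
        simp only [← symplectic_mul_frame, conjTranspose_mul, Matrix.mul_assoc]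
      _ = _ := by
        rw [frame_mul_conjTranspose c.2, Matrix.mul_sub, Matrix.sub_mul, Matrix.mul_smul,
          Matrix.smul_mul, map_ofReal_mul, map_ofReal_mul, map_ofReal_mul, map_ofReal_mul,
          conjTranspose_map_ofReal]
  have h_re := congrArg (fun Z => Z.map re) h_complex
  simp only [map_re_ofReal_sub] at h_re
  exact Subtype.ext h_re

theorem M_Psi (g : G d) (x : P d) : M (Psi g x).1 = momentAct g (M x.1) :=
  Prod.ext rfl (sigma_Phi g.2 ⟨x.1.2, x.2⟩)

end Equivariance

section Infinitesimal

open Complex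

theorem map_mem_symSubmodule {n α : Type} {Z : Matrix n n α} (hZ : Zᵀ = Z) (f : α → ℝ) :
    Z.map f ∈ symSubmodule n := by
  change (Z.map f)ᵀ = Z.map f
  rw [← transpose_map, hZ]

theorem toComplex_map_re_im {Z : Matrix (Fin d) (Fin d) ℂ} (hZ : Zᵀ = Z) :
    toComplex (⟨Z.map re, map_mem_symSubmodule hZ re⟩, ⟨Z.map im, map_mem_symSubmodule hZ im⟩) =
      Z :=
  map_re_add_map_im Z

theorem transpose_frame_mul_mul_frame_transpose (ξ : Sym2 d) (c : SiegelModel d) :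
    ((frame c)ᵀ * ξ.1.map ofReal * frame c)ᵀ = (frame c)ᵀ * ξ.1.map ofReal * frame c := by
  rw [transpose_mul, transpose_mul, transpose_transpose, ← transpose_map, Sym.transpose_eq,
    Matrix.mul_assoc]

/-- The generator of `ξ ∈ sym(2d, ℝ) ≅ sp(ℝ^{2d})` on `ℍ_d`. It is `Fᵀ ξ F` at `𝒞`, recorded as
the pair of its real and imaginary parts. -/
def siegelGen (ξ : Sym2 d) (c : SiegelModel d) : SiegelModel d :=
  (⟨_, map_mem_symSubmodule (transpose_frame_mul_mul_frame_transpose ξ c) re⟩,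
    ⟨_, map_mem_symSubmodule (transpose_frame_mul_mul_frame_transpose ξ c) im⟩)

theorem toComplex_siegelGen (ξ : Sym2 d) (c : SiegelModel d) :
    toComplex (siegelGen ξ c) = (frame c)ᵀ * ξ.1.map ofReal * frame c :=
  toComplex_map_re_im (transpose_frame_mul_mul_frame_transpose ξ c)

/-- The derivative of `σ` at `c` in the direction `v`, as the imaginary part of
`F ℬ⁻¹ V̄ ℬ⁻¹ Fᵀ`, where `V` is the complex matrix of `v`. -/
def dsigma (c v : SiegelModel d) : Sym2 d :=
  ⟨(frame c * ((c.2.1)⁻¹.map ofReal * (toComplex v)ᴴ * (c.2.1)⁻¹.map ofReal) * (frame c)ᵀ).map im,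
    map_mem_symSubmodule (by
      simp only [transpose_mul, transpose_transpose, ← transpose_map, transpose_nonsing_inv,
        Sym.transpose_eq, toComplex_conjTranspose_transpose,
        Matrix.mul_assoc]) im⟩

theorem inv_mul_toComplex_mul_inv (c v : SiegelModel d) :
    (c.2.1)⁻¹.map ofReal * (toComplex v)ᴴ * (c.2.1)⁻¹.map ofReal =
      ((c.2.1)⁻¹ * v.1.1 * (c.2.1)⁻¹).map ofReal +
        I • (-((c.2.1)⁻¹ * v.2.1 * (c.2.1)⁻¹)).map ofReal := by
  rw [Matrix.map_neg _ ofReal_neg, smul_neg, ← sub_eq_add_neg]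
  simp only [toComplex_conjTranspose, Matrix.mul_sub, Matrix.sub_mul, Matrix.mul_smul,
    Matrix.smul_mul, map_ofReal_mul]

theorem OmegaH_eq_im_trace (c u v : SiegelModel d) :
    OmegaH c u v = (trace (toComplex u *
      ((c.2.1)⁻¹.map ofReal * (toComplex v)ᴴ * (c.2.1)⁻¹.map ofReal))).im := by
  have h_cycle (N X Y : Matrix (Fin d) (Fin d) ℝ) :
      trace (N * X * N * Y) = trace (X * (N * Y * N)) := by
    rw [Matrix.mul_assoc, Matrix.mul_assoc, trace_mul_comm]
    simp only [Matrix.mul_assoc]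
  rw [inv_mul_toComplex_mul_inv, toComplex, map_ofReal_add_mul_map_ofReal_add, im_trace,
    map_im_ofReal_add, trace_add, Matrix.mul_neg, trace_neg, OmegaH, h_cycle,
    trace_mul_comm u.1.1, neg_add_eq_sub]

theorem OmegaH_siegelGen (c : SiegelModel d) (ξ : Sym2 d) (v : SiegelModel d) :
    OmegaH c (siegelGen ξ c) v = trace (ξ.1 * (dsigma c v).1) := by
  rw [OmegaH_eq_im_trace, toComplex_siegelGen, dsigma, ← map_im_ofReal_mul, ← im_trace,
    Matrix.mul_assoc, Matrix.mul_assoc, trace_mul_comm]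
  simp only [Matrix.mul_assoc]

theorem dsigma_siegelGen {c : SiegelModel d} (hc : c ∈ siegel d) (ξ : Sym2 d) :
    dsigma c (siegelGen ξ c) = -adStar ξ (sigma c) := by
  have h_conj : (toComplex (siegelGen ξ c))ᴴ = (frame c)ᴴ * ξ.1.map ofReal * (frame c)ᴴᵀ := by
    rw [toComplex_siegelGen, conjTranspose_mul, conjTranspose_mul, conjTranspose_map_ofReal,
      Sym.transpose_eq, Matrix.mul_assoc]
    rfl
  have h_complex :
      frame c * ((c.2.1)⁻¹.map ofReal * (toComplex (siegelGen ξ c))ᴴ * (c.2.1)⁻¹.map ofReal) *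
          (frame c)ᵀ =
        ((sigma c).1 * ξ.1 * (sigma c).1 + JJ d * ξ.1 * JJ d).map ofReal +
          I • ((sigma c).1 * ξ.1 * JJ d - JJ d * ξ.1 * (sigma c).1).map ofReal :=
    calc
      _ = (frame c * (c.2.1)⁻¹.map ofReal * (frame c)ᴴ) * ξ.1.map ofReal *
            ((frame c)ᴴᵀ * (c.2.1)⁻¹.map ofReal * (frame c)ᵀ) := by
        simp only [h_conj, Matrix.mul_assoc]
      _ = _ := by
        rw [frame_mul_conjTranspose hc, frame_conj_mul_transpose hc, Matrix.map_add _ ofReal_add,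
          Matrix.map_sub _ ofReal_sub]
        simp only [map_ofReal_mul, Matrix.mul_add, Matrix.sub_mul, Matrix.smul_mul,
          Matrix.mul_smul, smul_smul, I_mul_I, smul_sub]
        module
  apply Subtype.ext
  exact (congrArg (·.map im) h_complex).trans
    ((map_im_ofReal_add _ _).trans (neg_sub _ _).symm)

theorem exists_siegelGen_eq {c : SiegelModel d} (hc : c ∈ siegel d) (u : SiegelModel d) :
    ∃ ξ : Sym2 d, siegelGen ξ c = u := by
  have hu : IsUnit (c.2.1).det := (isUnit_iff_isUnit_det _).1 (isUnit_of_mem_siegel hc)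
  -- If `ξ` has the blocks `X`, `Y`, `Yᵀ` and `0`, then its generator is `X + Y 𝒞 + 𝒞 Yᵀ`.
  let Y : Matrix (Fin d) (Fin d) ℝ := (1 / 2 : ℝ) • (u.2.1 * (c.2.1)⁻¹)
  have hYT : Yᵀ = (1 / 2 : ℝ) • ((c.2.1)⁻¹ * u.2.1) := by
    simp only [Y, transpose_smul, transpose_mul, transpose_nonsing_inv, Sym.transpose_eq]
  have hY : Y * c.2.1 + c.2.1 * Yᵀ = u.2.1 := by
    rw [hYT, Matrix.smul_mul, Matrix.mul_smul, nonsing_inv_mul_cancel_right _ _ hu,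
      mul_nonsing_inv_cancel_left _ _ hu, ← add_smul]
    norm_num
  refine ⟨⟨fromBlocks (u.1.1 - Y * c.1.1 - c.1.1 * Yᵀ) Y Yᵀ 0, ?_⟩, toComplex_injective ?_⟩
  · change (_ : Matrix _ _ ℝ)ᵀ = _
    simp only [fromBlocks_transpose, transpose_sub, transpose_mul, transpose_transpose,
      Sym.transpose_eq, transpose_zero]
    congr 1
    abel
  · have h_complex : toComplex u = u.1.1.map ofReal + I • (Y * c.2.1 + c.2.1 * Yᵀ).map ofReal := by
      rw [hY, toComplex]
    rw [toComplex_siegelGen, Matrix.mul_assoc, map_ofReal_mul_frame, frame, transpose_fromRows,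
      fromCols_mul_fromRows, toComplex_transpose, transpose_one, h_complex]
    simp only [denom, numer, toComplex, toBlocks_fromBlocks₁₁, toBlocks_fromBlocks₁₂,
      toBlocks_fromBlocks₂₁, toBlocks_fromBlocks₂₂, Matrix.map_zero _ ofReal_zero,
      Matrix.map_add _ ofReal_add, Matrix.map_sub _ ofReal_sub, map_ofReal_mul, Matrix.mul_add,
      Matrix.add_mul, Matrix.smul_mul, Matrix.mul_smul, Matrix.one_mul, Matrix.zero_mul,
      Matrix.mul_zero, smul_zero, smul_add]
    abel

end Infinitesimal

section Derivatives

open Complex in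
theorem coe_dsigma {c : SiegelModel d} (hc : c ∈ siegel d) (v : SiegelModel d) :
    (dsigma c v).1 =
      fromBlocks (-((c.2.1)⁻¹ * v.2.1 * (c.2.1)⁻¹))
        (-((c.2.1)⁻¹ * v.2.1 * (c.2.1)⁻¹) * c.1.1 + (c.2.1)⁻¹ * v.1.1)
        (v.1.1 * (c.2.1)⁻¹ + c.1.1 * -((c.2.1)⁻¹ * v.2.1 * (c.2.1)⁻¹))
        ((v.1.1 * (c.2.1)⁻¹ + c.1.1 * -((c.2.1)⁻¹ * v.2.1 * (c.2.1)⁻¹)) * c.1.1 +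
          c.1.1 * (c.2.1)⁻¹ * v.1.1 + v.2.1) := by
  have hu : IsUnit (c.2.1).det := (isUnit_iff_isUnit_det _).1 (isUnit_of_mem_siegel hc)
  change Matrix.map (frame c * (_ : Matrix (Fin d) (Fin d) ℂ) * (frame c)ᵀ) im = _
  rw [inv_mul_toComplex_mul_inv, frame, transpose_fromRows, fromRows_mul,
    fromRows_mul_fromCols, transpose_one, toComplex_transpose, toComplex, fromBlocks_map]
  simp only [Matrix.one_mul, Matrix.mul_one, map_ofReal_add_mul_map_ofReal_add, map_im_ofReal_add]
  congr 1
  · rw [nonsing_inv_mul_cancel_right _ _ hu, add_comm]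
  · rw [← Matrix.mul_assoc, mul_nonsing_inv_cancel_left _ _ hu, add_comm]
  · simp only [Matrix.mul_neg, sub_neg_eq_add, ← Matrix.mul_assoc, mul_nonsing_inv _ hu,
      Matrix.one_mul, Matrix.add_mul, nonsing_inv_mul_cancel_right _ _ hu]
    abel

theorem contDiffAt_sigma {r : WithTop ℕ∞} {c : SiegelModel d} (hc : c ∈ siegel d) :
    ContDiffAt ℝ r sigma c := by
  have hA : ContDiffAt ℝ r (fun y : SiegelModel d => y.1.1) c := contDiffAt_sym.1 contDiffAt_fst
  have hB : ContDiffAt ℝ r (fun y : SiegelModel d => y.2.1) c := contDiffAt_sym.1 contDiffAt_snd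
  have hN := contDiffAt_matrix_inv hB (isUnit_of_mem_siegel hc)
  have hAN := contDiffAt_matrix_mul hA hN
  rw [contDiffAt_sym]
  exact contDiffAt_fromBlocks hN (contDiffAt_matrix_mul hN hA) hAN
    ((contDiffAt_matrix_mul hAN hA).add hB)

theorem hasDerivAt_sigma_comp {f : ℝ → SiegelModel d} {f' : SiegelModel d} {t : ℝ}
    (hf : HasDerivAt f f' t) (ht : f t ∈ siegel d) :
    HasDerivAt (fun s => sigma (f s)) (dsigma (f t) f') t := by
  have hA : HasDerivAt (fun s => (f s).1.1) f'.1.1 t := hasDerivAt_sym.1 hf.fst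
  have hB : HasDerivAt (fun s => (f s).2.1) f'.2.1 t := hasDerivAt_sym.1 hf.snd
  have hN := hasDerivAt_matrix_inv hB (isUnit_of_mem_siegel ht)
  have hAN := hasDerivAt_matrix_mul hA hN
  rw [hasDerivAt_sym, coe_dsigma ht]
  exact hasDerivAt_fromBlocks hN (hasDerivAt_matrix_mul hN hA) hAN
    ((hasDerivAt_matrix_mul hAN hA).add hB)

theorem fderiv_sigma {c : SiegelModel d} (hc : c ∈ siegel d) (v : SiegelModel d) :
    fderiv ℝ sigma c v = dsigma c v := by
  have h_diff : DifferentiableAt ℝ (sigma (d := d)) c :=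
    (contDiffAt_sigma (r := 1) hc).differentiableAt one_ne_zero
  have h_zero : c + (0 : ℝ) • v = c := by rw [zero_smul, add_zero]
  have h_sigma := hasDerivAt_sigma_comp (hasDerivAt_add_smul c v) (by rwa [h_zero])
  rw [h_zero] at h_sigma
  exact (h_diff.hasFDerivAt.hasLineDerivAt v).unique h_sigma

theorem contDiffAt_M {r : WithTop ℕ∞} {x : PModel d} (hx : x ∈ P d) : ContDiffAt ℝ r M x :=
  contDiffAt_fst.prodMk ((contDiffAt_sigma hx).comp x contDiffAt_snd)

theorem differentiableAt_M {x : PModel d} (hx : x ∈ P d) : DifferentiableAt ℝ M x :=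
  (contDiffAt_M (r := 1) hx).differentiableAt one_ne_zero

theorem fderiv_M {x : PModel d} (hx : x ∈ P d) (v : PModel d) :
    fderiv ℝ M x v = (v.1, dsigma x.2 v.2) := by
  have h_sigma : DifferentiableAt ℝ (sigma (d := d)) x.2 :=
    (contDiffAt_sigma (r := 1) hx).differentiableAt one_ne_zero
  have h : HasFDerivAt (M (d := d)) _ x :=
    hasFDerivAt_fst.prodMk (h_sigma.hasFDerivAt.comp x hasFDerivAt_snd)
  rw [h.fderiv, ← fderiv_sigma hx]
  rfl

end Derivatives

section InverseOfSigma

/-- A smooth left inverse of `σ` on `ℍ_d`, which reads `ℬ⁻¹` and `ℬ⁻¹ 𝒜` off the upper blocks. -/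
def sigmaInv (μ : Sym2 d) : SiegelModel d :=
  (symProj ((μ.1.toBlocks₁₁)⁻¹ * μ.1.toBlocks₁₂), symProj (μ.1.toBlocks₁₁)⁻¹)

theorem leftInvOn_sigmaInv : Set.LeftInvOn sigmaInv sigma (siegel d) := by
  intro c hc
  have hu : IsUnit (c.2.1).det := (isUnit_iff_isUnit_det _).1 (isUnit_of_mem_siegel hc)
  simp only [sigmaInv, sigma, toBlocks_fromBlocks₁₁, toBlocks_fromBlocks₁₂,
    nonsing_inv_nonsing_inv _ hu, mul_nonsing_inv_cancel_left _ _ hu, symProj_coe, Prod.mk.eta]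

theorem contDiffAt_sigmaInv {r : WithTop ℕ∞} {μ : Sym2 d} (hμ : IsUnit μ.1.toBlocks₁₁) :
    ContDiffAt ℝ r sigmaInv μ := by
  have h_coe : ContDiffAt ℝ r (fun ν : Sym2 d => ν.1) μ := contDiffAt_sym.1 contDiffAt_id
  have h₁₁ : ContDiffAt ℝ r (fun ν : Sym2 d => ν.1.toBlocks₁₁) μ :=
    contDiffAt_matrix.2 fun i j => contDiffAt_matrix.1 h_coe (.inl i) (.inl j)
  have h₁₂ : ContDiffAt ℝ r (fun ν : Sym2 d => ν.1.toBlocks₁₂) μ :=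
    contDiffAt_matrix.2 fun i j => contDiffAt_matrix.1 h_coe (.inl i) (.inr j)
  have h_inv := contDiffAt_matrix_inv h₁₁ hμ
  exact (symProj.contDiff.contDiffAt.comp μ (contDiffAt_matrix_mul h_inv h₁₂)).prodMk
    (symProj.contDiff.contDiffAt.comp μ h_inv)

theorem differentiableAt_sigmaInv {c : SiegelModel d} (hc : c ∈ siegel d) :
    DifferentiableAt ℝ sigmaInv (sigma c) := by
  refine (contDiffAt_sigmaInv (r := 1) ?_).differentiableAt one_ne_zero
  simpa only [sigma, toBlocks_fromBlocks₁₁] using isUnit_nonsing_inv_iff.2 (isUnit_of_mem_siegel hc)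

theorem fderiv_sigmaInv_dsigma {c : SiegelModel d} (hc : c ∈ siegel d) (v : SiegelModel d) :
    fderiv ℝ sigmaInv (sigma c) (dsigma c v) = v := by
  have h_open : IsOpen (siegel d) := isOpen_posDef.preimage continuous_snd
  have h_sigma : DifferentiableAt ℝ sigma c :=
    (contDiffAt_sigma (r := 1) hc).differentiableAt one_ne_zero
  have h_comp := (differentiableAt_sigmaInv hc).hasFDerivAt.comp c h_sigma.hasFDerivAt
  have h_id := (hasFDerivAt_id (𝕜 := ℝ) c).congr_of_eventuallyEq
    (Filter.mem_of_superset (h_open.mem_nhds hc) leftInvOn_sigmaInv)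
  rw [← fderiv_sigma hc]
  exact DFunLike.congr_fun (h_comp.unique h_id) v

theorem hasDerivAt_of_sigma_comp {f : ℝ → SiegelModel d} {f' : SiegelModel d} {t : ℝ}
    (hf : ∀ s, f s ∈ siegel d) (h : HasDerivAt (fun s => sigma (f s)) (dsigma (f t) f') t) :
    HasDerivAt f f' t := by
  have h_comp := (differentiableAt_sigmaInv (hf t)).hasFDerivAt.comp_hasDerivAt t h
  exact (h_comp.congr_deriv (fderiv_sigmaInv_dsigma (hf t) f')).congr_of_eventuallyEq
    (.of_forall fun s => (leftInvOn_sigmaInv (hf s)).symm)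

end InverseOfSigma

section Generators

theorem tilde_smul (t : ℝ) (ξ : Sym2 d) : tilde (t • ξ) = t • tilde ξ := by
  simp only [tilde, Submodule.coe_smul, Matrix.mul_smul]

theorem exp_tilde_zero_smul (ξ : Sym2 d) : NormedSpace.exp (tilde ((0 : ℝ) • ξ)) = 1 := by
  rw [tilde_smul, zero_smul, NormedSpace.exp_zero]

theorem hasDerivAt_coAd_exp (ξ μ : Sym2 d) :
    HasDerivAt (fun t : ℝ => coAd ⟨NormedSpace.exp (tilde (t • ξ)), exp_tilde_mem (t • ξ)⟩ μ)
      (-adStar ξ μ) 0 := by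
  have h_exp : HasDerivAt (fun t : ℝ => NormedSpace.exp (tilde (t • ξ))) (tilde ξ) 0 := by
    simp only [tilde_smul]
    exact hasDerivAt_exp_smul_matrix _
  have h := hasDerivAt_matrix_mul (hasDerivAt_matrix_mul h_exp (hasDerivAt_const (0 : ℝ) μ.1))
    (hasDerivAt_matrix_transpose h_exp)
  refine hasDerivAt_sym.2 (h.congr_deriv ?_)
  rw [exp_tilde_zero_smul]
  simp only [tilde, Submodule.coe_neg, adStar, transpose_one, transpose_mul, transpose_neg,
    Matrix.mul_neg, neg_neg, Sym.transpose_eq, JJ_transpose, Matrix.mul_one, Matrix.one_mul,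
    Matrix.mul_zero, add_zero, Matrix.neg_mul, neg_sub, Matrix.mul_assoc]
  abel

theorem hasDerivAt_Phi_exp (ξ : Sym2 d) (c : siegel d) :
    HasDerivAt
      (fun t : ℝ => (Phi ⟨NormedSpace.exp (tilde (t • ξ)), exp_tilde_mem (t • ξ)⟩ c).1)
      (siegelGen ξ c) 0 := by
  have h_zero : (⟨NormedSpace.exp (tilde ((0 : ℝ) • ξ)), exp_tilde_mem ((0 : ℝ) • ξ)⟩ :
      symplecticGroup (Fin d) ℝ) = 1 := Subtype.ext (exp_tilde_zero_smul ξ)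
  refine hasDerivAt_of_sigma_comp (fun _ => (Phi _ c).2) ?_
  rw [h_zero, Phi_one, dsigma_siegelGen c.2]
  simp only [sigma_Phi]
  exact hasDerivAt_coAd_exp ξ (sigma c)

theorem hasDerivAt_orbitCurve (a : PhaseSpace d × Sym2 d) (x : P d) :
    HasDerivAt (orbitCurve a x) (JJ d *ᵥ a.1, siegelGen a.2 x.1.2) 0 := by
  have h_translation : HasDerivAt (fun t : ℝ => x.1.1 + JJ d *ᵥ (t • a.1)) (JJ d *ᵥ a.1) 0 := by
    simp only [mulVec_smul]
    exact hasDerivAt_add_smul x.1.1 (JJ d *ᵥ a.1)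
  exact h_translation.prodMk (hasDerivAt_Phi_exp a.2 ⟨x.1.2, x.2⟩)

theorem infGen_eq (a : PhaseSpace d × Sym2 d) (x : P d) :
    infGen a x = (JJ d *ᵥ a.1, siegelGen a.2 x.1.2) :=
  (hasDerivAt_orbitCurve a x).deriv

end Generators

section CoadjointOrbit

theorem coAd_one (μ : Sym2 d) : coAd 1 μ = μ := by
  apply Subtype.ext
  simp only [coAd, OneMemClass.coe_one, transpose_one, Matrix.one_mul, Matrix.mul_one]

theorem coAd_mul (S S' : symplecticGroup (Fin d) ℝ) (μ : Sym2 d) :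
    coAd (S * S') μ = coAd S (coAd S' μ) := by
  apply Subtype.ext
  simp only [coAd, Submonoid.coe_mul, transpose_mul, Matrix.mul_assoc]

open scoped MatrixOrder in
theorem exists_isUnit_eq_mul_transpose {n : Type*} [Fintype n] [DecidableEq n]
    {B : Matrix n n ℝ} (hB : B.PosDef) : ∃ R : Matrix n n ℝ, IsUnit R ∧ B = R * Rᵀ := by
  obtain ⟨R, hR⟩ := CStarAlgebra.nonneg_iff_eq_star_mul_self.mp hB.posSemidef.nonneg
  rw [star_eq_conjTranspose, conjTranspose_eq_transpose_of_trivial] at hR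
  have h_unit : IsUnit (Rᵀ * R).det := hR ▸ (isUnit_iff_isUnit_det _).1 hB.isUnit
  rw [det_mul] at h_unit
  exact ⟨Rᵀ, (isUnit_iff_isUnit_det _).2 (isUnit_of_mul_isUnit_left h_unit),
    by rw [transpose_transpose, hR]⟩

/-- The unit of `sym(2d, ℝ)`, which is `σ(iI)`. -/
def symOne (d : ℕ) : Sym2 d := ⟨1, transpose_one⟩

theorem exists_coAd_symOne_eq_sigma {c : SiegelModel d} (hc : c ∈ siegel d) :
    ∃ S, coAd S (symOne d) = sigma c := by
  obtain ⟨R, hR, h_im⟩ := exists_isUnit_eq_mul_transpose (B := c.2.1) hc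
  have hR_det : IsUnit R.det := (isUnit_iff_isUnit_det _).1 hR
  have h_inv : (c.2.1)⁻¹ = (Rᵀ)⁻¹ * R⁻¹ := by rw [h_im, Matrix.mul_inv_rev]
  -- This is the matrix of `𝒞 ↦ R 𝒞 Rᵀ + 𝒜`, which takes `iI` to `𝒜 + iℬ`.
  refine ⟨⟨fromBlocks (Rᵀ)⁻¹ 0 (c.1.1 * (Rᵀ)⁻¹) R, ?_⟩, Subtype.ext ?_⟩
  · rw [SymplecticGroup.fromBlocks_mem_iff]
    simp only [transpose_mul, transpose_nonsing_inv, transpose_transpose, Sym.transpose_eq,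
      transpose_zero, Matrix.zero_mul, Matrix.mul_zero, sub_zero, Matrix.mul_assoc,
      nonsing_inv_mul _ hR_det, and_self]
  · simp only [coAd, symOne, sigma, Matrix.mul_one, fromBlocks_transpose, fromBlocks_multiply,
      transpose_mul, transpose_nonsing_inv, transpose_transpose, Sym.transpose_eq,
      transpose_zero, Matrix.zero_mul, Matrix.mul_zero, add_zero, Matrix.mul_assoc, h_inv]
    rw [← h_im]

theorem sigma_mem_coadjointOrbit {c c' : SiegelModel d} {μ : Sym2 d} (hc : c ∈ siegel d)
    (hc' : c' ∈ siegel d) (h : sigma c ∈ coadjointOrbit μ) : sigma c' ∈ coadjointOrbit μ := by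
  obtain ⟨S, hS⟩ := exists_coAd_symOne_eq_sigma hc
  obtain ⟨S', hS'⟩ := exists_coAd_symOne_eq_sigma hc'
  obtain ⟨T, hT : coAd T μ = sigma c⟩ := h
  have h_inv : coAd S⁻¹ (sigma c) = symOne d := by rw [← hS, ← coAd_mul, inv_mul_cancel, coAd_one]
  exact ⟨S' * (S⁻¹ * T), show coAd _ μ = _ by rw [coAd_mul, coAd_mul, hT, h_inv, hS']⟩

theorem exists_M_eq {c : SiegelModel d} (hc : c ∈ siegel d) {w : Moments d}
    (hw : w.2 ∈ coadjointOrbit (sigma c)) : ∃ x ∈ P d, M x = w := by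
  obtain ⟨S, hS⟩ := hw
  exact ⟨(w.1, (Phi S ⟨c, hc⟩).1), (Phi S ⟨c, hc⟩).2, Prod.ext rfl ((sigma_Phi S ⟨c, hc⟩).trans hS)⟩

end CoadjointOrbit

section OrbitForm

theorem adStar_smul (r : ℝ) (ξ μ : Sym2 d) : adStar (r • ξ) μ = r • adStar ξ μ := by
  apply Subtype.ext
  simp only [adStar, Submodule.coe_smul, Matrix.mul_smul, Matrix.smul_mul, smul_sub]

theorem adStar_neg (ξ μ : Sym2 d) : adStar (-ξ) μ = -adStar ξ μ := by
  apply Subtype.ext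
  simp only [adStar, Submodule.coe_neg, Matrix.mul_neg, Matrix.neg_mul, neg_sub_neg, neg_sub]

theorem dsigma_siegelGen_neg {c : SiegelModel d} (hc : c ∈ siegel d) (ξ : Sym2 d) :
    dsigma c (siegelGen (-ξ) c) = adStar ξ (sigma c) := by
  rw [dsigma_siegelGen hc, adStar_neg, neg_neg]

theorem kks_dsigma {c : SiegelModel d} (hc : c ∈ siegel d) (u v : SiegelModel d) :
    kks (sigma c) (dsigma c u) (dsigma c v) = OmegaH c u v := by
  obtain ⟨ξ, rfl⟩ := exists_siegelGen_eq hc u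
  obtain ⟨η, rfl⟩ := exists_siegelGen_eq hc v
  rw [OmegaH_siegelGen, dsigma_siegelGen hc, dsigma_siegelGen hc, ← adStar_neg, ← adStar_neg,
    kks_adStar, trace_mul_symBracket', trace_mul_comm, Submodule.coe_neg, Matrix.neg_mul,
    trace_neg, neg_neg]

theorem omega_fderiv_M (ħ : ℝ) {x : PModel d} (hx : x ∈ P d) (u v : PModel d) :
    omega ħ (M x) (fderiv ℝ M x u) (fderiv ℝ M x v) = Omega ħ x u v := by
  rw [fderiv_M hx, fderiv_M hx, omega, Omega, M, kks_dsigma hx]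

theorem mem_momentTangent_M_iff {x : PModel d} (hx : x ∈ P d) {u : Moments d} :
    u ∈ momentTangent (M x) ↔ ∃ v, fderiv ℝ M x v = u := by
  constructor
  · rintro ⟨ξ, hξ⟩
    refine ⟨(u.1, siegelGen (-ξ) x.2), ?_⟩
    rw [fderiv_M hx, dsigma_siegelGen_neg hx]
    exact Prod.ext rfl hξ
  · rintro ⟨v, rfl⟩
    obtain ⟨ξ, hξ⟩ := exists_siegelGen_eq (c := x.2) hx v.2
    refine ⟨-ξ, ?_⟩
    rw [fderiv_M hx, ← hξ, dsigma_siegelGen hx, ← adStar_neg]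
    rfl

end OrbitForm

section MomentumMap

theorem OmegaR_JJ_mulVec (g v : PhaseSpace d) : OmegaR (JJ d *ᵥ g) v = g ⬝ᵥ v := by
  rw [OmegaR, dotProduct_mulVec, ← mulVec_transpose, mulVec_mulVec, JJ_transpose_mul, one_mulVec]

/-- The pairing as a continuous linear form in its first argument. -/
def pairingL (ħ : ℝ) (a : PhaseSpace d × Sym2 d) : Moments d →L[ℝ] ℝ :=
  LinearMap.toContinuousLinearMap
    { toFun := fun w => pairing ħ w a
      map_add' := fun w w' => by
        simp only [pairing, Prod.fst_add, Prod.snd_add, add_dotProduct, Submodule.coe_add,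
          Matrix.add_mul, trace_add]
        ring
      map_smul' := fun r w => by
        simp only [pairing, Prod.smul_fst, Prod.smul_snd, smul_dotProduct, Submodule.coe_smul,
          Matrix.smul_mul, trace_smul, smul_eq_mul, RingHom.id_apply]
        ring }

theorem fderiv_pairing (ħ : ℝ) (a : PhaseSpace d × Sym2 d) {K : PModel d → Moments d}
    {x : PModel d} (hK : DifferentiableAt ℝ K x) (v : PModel d) :
    fderiv ℝ (fun y => pairing ħ (K y) a) x v = pairing ħ (fderiv ℝ K x v) a :=
  DFunLike.congr_fun ((pairingL ħ a).hasFDerivAt.comp x hK.hasFDerivAt).fderiv v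

theorem eq_of_pairing_eq {ħ : ℝ} (hħ : ħ ≠ 0) {w w' : Moments d}
    (h : ∀ a, pairing ħ w a = pairing ħ w' a) : w = w' := by
  have h_sub (a) : pairing ħ (w - w') a = 0 :=
    ((pairingL ħ a).map_sub w w').trans (sub_eq_zero.2 (h a))
  have h_fst := h_sub ((w - w').1, 0)
  have h_snd := h_sub (0, (w - w').2)
  simp only [pairing, ZeroMemClass.coe_zero, trace_zero, mul_zero, sub_zero,
    dotProduct_zero, zero_sub, neg_eq_zero, mul_eq_zero, div_eq_zero_iff, hħ, false_or,
    OfNat.ofNat_ne_zero] at h_fst h_snd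
  exact sub_eq_zero.1 (Prod.ext (dotProduct_self_eq_zero.1 h_fst)
    (eq_zero_of_trace_mul_self _ h_snd))

theorem isMomentumMap_M (ħ : ℝ) : IsMomentumMap ħ (M (d := d)) := by
  refine ⟨fun x hx => (contDiffAt_M hx).contDiffWithinAt, fun a x v => ?_⟩
  rw [fderiv_pairing ħ a (differentiableAt_M x.2), infGen_eq, Omega, OmegaR_JJ_mulVec,
    OmegaH_siegelGen, fderiv_M x.2, pairing, dotProduct_comm, trace_mul_comm]

theorem IsMomentumMap.exists_eq_M_add {ħ : ℝ} (hħ : ħ ≠ 0) {K : PModel d → Moments d}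
    (hK : IsMomentumMap ħ K) : ∃ c : Moments d, ∀ x ∈ P d, K x = M x + c := by
  have hK_diff (x) (hx : x ∈ P d) : DifferentiableAt ℝ K x :=
    (hK.1.contDiffAt (isOpen_P.mem_nhds hx)).differentiableAt (by simp)
  have h_fderiv (x) (hx : x ∈ P d) : fderiv ℝ K x = fderiv ℝ M x := by
    refine ContinuousLinearMap.ext fun v => eq_of_pairing_eq hħ fun a => ?_
    rw [← fderiv_pairing ħ a (hK_diff x hx), ← fderiv_pairing ħ a (differentiableAt_M hx),
      ← hK.2 a ⟨x, hx⟩, ← (isMomentumMap_M ħ).2 a ⟨x, hx⟩]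
  obtain ⟨c, hc⟩ := isOpen_P.exists_eq_add_of_fderiv_eq convex_P.isPreconnected
    (fun x hx => (hK_diff x hx).differentiableWithinAt)
    (fun x hx => (differentiableAt_M hx).differentiableWithinAt) h_fderiv
  exact ⟨c, hc⟩

end MomentumMap

section CollectiveHamiltonians

theorem fderiv_moments_apply (f : Moments d → ℝ) (w v : Moments d) :
    fderiv ℝ f w v = dz f w ⬝ᵥ v.1 + trace ((dSigma f w).1 * v.2.1) := by
  have h_split : v = ContinuousLinearMap.inl ℝ _ _ v.1 + ContinuousLinearMap.inr ℝ _ _ v.2 := by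
    simp
  have h_basis : v.1 = ∑ i, v.1 i • (Pi.single i 1 : PhaseSpace d) :=
    pi_eq_sum_univ' v.1
  have h_inl : fderiv ℝ f w (ContinuousLinearMap.inl ℝ _ _ v.1) = dz f w ⬝ᵥ v.1 := by
    conv_lhs => rw [h_basis]
    simp only [map_sum, map_smul, smul_eq_mul, dotProduct, dz]
    exact Finset.sum_congr rfl fun i _ => mul_comm _ _
  have h_inr : fderiv ℝ f w (ContinuousLinearMap.inr ℝ _ _ v.2) =
      trace ((dSigma f w).1 * v.2.1) :=
    (trace_symGrad_mul ((fderiv ℝ f w).toLinearMap ∘ₗ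
      LinearMap.inr ℝ (PhaseSpace d) (Sym2 d)) v.2).symm
  conv_lhs => rw [h_split, map_add, h_inl, h_inr]

theorem Omega_hamVec {ħ : ℝ} (hħ : ħ ≠ 0) (F : PModel d → ℝ) {x : PModel d} (hx : x ∈ P d)
    (v : PModel d) : Omega ħ x (hamVec ħ F x) v = fderiv ℝ F x v :=
  Classical.epsilon_spec (existsUnique_hamVec hħ hx (fderiv ℝ F x)).exists v

theorem eq_hamVec_of_Omega {ħ : ℝ} (hħ : ħ ≠ 0) {F : PModel d → ℝ} {x : PModel d} (hx : x ∈ P d)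
    {X : PModel d} (hX : ∀ v, Omega ħ x X v = fderiv ℝ F x v) : X = hamVec ħ F x :=
  (existsUnique_hamVec hħ hx (fderiv ℝ F x)).unique hX (Omega_hamVec hħ F hx)

theorem fderiv_comp_M {f : Moments d → ℝ} {x : PModel d} (hx : x ∈ P d)
    (hf : DifferentiableAt ℝ f (M x)) (v : PModel d) :
    fderiv ℝ (f ∘ M) x v = fderiv ℝ f (M x) (fderiv ℝ M x v) :=
  DFunLike.congr_fun (fderiv_comp x hf (differentiableAt_M hx)) v

theorem hamVec_congr (ħ : ℝ) {F K : PModel d → ℝ} (hFK : Set.EqOn F K (P d)) {x : PModel d}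
    (hx : x ∈ P d) : hamVec ħ F x = hamVec ħ K x := by
  rw [hamVec, hamVec, (hFK.eventuallyEq_of_mem (isOpen_P.mem_nhds hx)).fderiv_eq]

theorem hamVec_comp_M {ħ : ℝ} (hħ : ħ ≠ 0) {f : Moments d → ℝ} {x : PModel d} (hx : x ∈ P d)
    (hf : DifferentiableAt ℝ f (M x)) :
    hamVec ħ (f ∘ M) x =
      (JJ d *ᵥ dz f (M x), siegelGen (-((4 / ħ) • dSigma f (M x))) x.2) := by
  refine (eq_hamVec_of_Omega hħ hx fun v => ?_).symm
  rw [fderiv_comp_M hx hf, fderiv_M hx, fderiv_moments_apply, Omega, OmegaR_JJ_mulVec,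
    OmegaH_siegelGen, Submodule.coe_neg, Submodule.coe_smul, Matrix.neg_mul, Matrix.smul_mul,
    trace_neg, trace_smul, smul_eq_mul]
  field_simp
  ring

/-- The Hamiltonian vector field `ż = 𝕁 ∂f/∂z`, `Σ̇ = (4/ħ) ad^*_{δf/δΣ} Σ` of a function `f` of the
moments. It is given on all of `ℝ^{2d} × sym(2d, ℝ)`, not only on the orbits. -/
def hamVecMoments (ħ : ℝ) (f : Moments d → ℝ) (w : Moments d) : Moments d :=
  (JJ d *ᵥ dz f w, (4 / ħ) • adStar (dSigma f w) w.2)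

theorem fderiv_M_hamVec {ħ : ℝ} (hħ : ħ ≠ 0) {f : Moments d → ℝ} {x : PModel d} (hx : x ∈ P d)
    (hf : DifferentiableAt ℝ f (M x)) :
    fderiv ℝ M x (hamVec ħ (f ∘ M) x) = hamVecMoments ħ f (M x) := by
  rw [hamVec_comp_M hħ hx hf, fderiv_M hx, dsigma_siegelGen_neg hx, adStar_smul]
  rfl

theorem dotProduct_JJ_mulVec (u v : PhaseSpace d) :
    u ⬝ᵥ JJ d *ᵥ v = ∑ i, (u (.inl i) * v (.inr i) - v (.inl i) * u (.inr i)) := by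
  simp only [JJ, dotProduct, fromBlocks_mulVec, Fintype.sum_sum_type, Sum.elim_inl, Sum.elim_inr,
    zero_mulVec, one_mulVec, neg_mulVec, zero_add, add_zero, Pi.neg_apply, Function.comp_apply,
    ← Finset.sum_add_distrib, neg_mul, sub_eq_add_neg, mul_comm (u (.inr _))]

theorem poissonP_comp_M {ħ : ℝ} (hħ : ħ ≠ 0) {f g : Moments d → ℝ} {x : PModel d}
    (hx : x ∈ P d) (hf : DifferentiableAt ℝ f (M x)) (hg : DifferentiableAt ℝ g (M x)) :
    poissonP ħ (f ∘ M) (g ∘ M) x = poissonMoments ħ f g (M x) := by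
  rw [poissonP, Omega_hamVec hħ _ hx, fderiv_comp_M hx hf, fderiv_M_hamVec hħ hx hg,
    hamVecMoments, fderiv_moments_apply, dotProduct_JJ_mulVec, poissonMoments, poissonR,
    trace_mul_symBracket', Submodule.coe_smul, Matrix.mul_smul, trace_smul, smul_eq_mul,
    trace_mul_comm (dSigma f (M x)).1]
  ring

theorem isHamVecMoments_M_iff {ħ : ℝ} (hħ : ħ ≠ 0) {f : Moments d → ℝ} {x : PModel d}
    (hx : x ∈ P d) (hf : DifferentiableAt ℝ f (M x)) {Y : Moments d} :
    IsHamVecMoments ħ f (M x) Y ↔ Y = hamVecMoments ħ f (M x) := by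
  rw [← fderiv_M_hamVec hħ hx hf]
  constructor
  · rintro ⟨h_tangent, h_omega⟩
    obtain ⟨X, rfl⟩ := (mem_momentTangent_M_iff hx).1 h_tangent
    congr 1
    refine eq_hamVec_of_Omega hħ hx fun v => ?_
    rw [← omega_fderiv_M ħ hx, h_omega _ ((mem_momentTangent_M_iff hx).2 ⟨v, rfl⟩),
      fderiv_comp_M hx hf]
  · rintro rfl
    refine ⟨(mem_momentTangent_M_iff hx).2 ⟨_, rfl⟩, fun u hu => ?_⟩
    obtain ⟨v, rfl⟩ := (mem_momentTangent_M_iff hx).1 hu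
    rw [omega_fderiv_M ħ hx, Omega_hamVec hħ _ hx, fderiv_comp_M hx hf]

theorem isHamVecMoments_iff {ħ : ℝ} (hħ : ħ ≠ 0) {f : Moments d → ℝ} (hf : Differentiable ℝ f)
    {c : SiegelModel d} (hc : c ∈ siegel d) {w : Moments d} (hw : w.2 ∈ coadjointOrbit (sigma c))
    {Y : Moments d} : IsHamVecMoments ħ f w Y ↔ Y = hamVecMoments ħ f w := by
  obtain ⟨x, hx, rfl⟩ := exists_M_eq hc hw
  exact isHamVecMoments_M_iff hħ hx (hf _)

theorem forall_eq_fderiv_M_hamVec_iff {ħ : ℝ} (hħ : ħ ≠ 0) {f : Moments d → ℝ}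
    (hf : Differentiable ℝ f) {F : PModel d → ℝ} (hF : Set.EqOn F (f ∘ M) (P d))
    {c : SiegelModel d} (hc : c ∈ siegel d)
    {X : {w : Moments d // w.2 ∈ coadjointOrbit (sigma c)} → Moments d} :
    (∀ x ∈ P d, ∀ w, w.1 = M x → X w = fderiv ℝ M x (hamVec ħ F x)) ↔
      ∀ w, X w = hamVecMoments ħ f w.1 := by
  have h_push (x) (hx : x ∈ P d) : fderiv ℝ M x (hamVec ħ F x) = hamVecMoments ħ f (M x) := by
    rw [hamVec_congr ħ hF hx, fderiv_M_hamVec hħ hx (hf _)]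
  constructor
  · intro hX w
    obtain ⟨x, hx, hxw⟩ := exists_M_eq hc w.2
    rw [hX x hx w hxw.symm, h_push x hx, hxw]
  · intro hX x hx w hw
    rw [hX, h_push x hx, hw]

theorem poissonR_coord (f : Moments d → ℝ) (w : Moments d) (i : Fin d ⊕ Fin d) :
    poissonR (fun w' => w'.1 i) f w = (JJ d *ᵥ dz f w) i := by
  have h_dz : dz (fun w' : Moments d => w'.1 i) w = Pi.single i 1 := by
    funext j
    have h := (hasFDerivAt_apply (𝕜 := ℝ) i w.1).comp w hasFDerivAt_fst
    refine (DFunLike.congr_fun h.fderiv (Pi.single j 1, 0)).trans ?_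
    exact Pi.single_comm _ _ _
  rw [poissonR, h_dz, ← dotProduct_JJ_mulVec, single_one_dotProduct]

end CollectiveHamiltonians

section PartialDerivatives

variable {ι κ : Type}

theorem fderiv_comp_reindex [Finite ι] [Finite κ] {e : κ → ι} {g : (κ → ℝ) → ℝ} {z : ι → ℝ}
    (hg : DifferentiableAt ℝ g (z ∘ e)) (u : ι → ℝ) :
    fderiv ℝ (fun y => g (y ∘ e)) z u = fderiv ℝ g (z ∘ e) (u ∘ e) := by
  cases nonempty_fintype ι
  cases nonempty_fintype κ
  exact DFunLike.congr_fun
    (hg.hasFDerivAt.comp z (Pi.compRightL ℝ (fun _ : ι => ℝ) e).hasFDerivAt).fderiv u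

variable [Fintype ι] [DecidableEq ι]

theorem contDiff_pderiv {f : (ι → ℝ) → ℝ} {r s : WithTop ℕ∞} (hf : ContDiff ℝ r f)
    (hs : s + 1 ≤ r) (i : ι) : ContDiff ℝ s (pderiv f i) :=
  (hf.fderiv_right hs).clm_apply contDiff_const

theorem contDiff_hessian {f : (ι → ℝ) → ℝ} (hf : ContDiff ℝ 3 f) : ContDiff ℝ 1 (hessian f) :=
  contDiff_iff_contDiffAt.2 fun _ => contDiffAt_matrix.2 fun i j =>
    (contDiff_pderiv (contDiff_pderiv (s := 2) hf (by norm_num) j) (by norm_num) i).contDiffAt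

theorem hessian_apply {f : (ι → ℝ) → ℝ} (hf : ContDiff ℝ 2 f) (x : ι → ℝ) (i j : ι) :
    hessian f x i j = fderiv ℝ (fderiv ℝ f) x (Pi.single i 1) (Pi.single j 1) := by
  have h_diff : DifferentiableAt ℝ (fderiv ℝ f) x :=
    (hf.fderiv_right (m := 1) (by norm_num)).differentiable one_ne_zero x
  change fderiv ℝ (fun y => fderiv ℝ f y (Pi.single j 1)) x (Pi.single i 1) = _
  rw [fderiv_clm_apply h_diff (differentiableAt_const _), fderiv_const_apply]
  simp

theorem hessian_transpose {f : (ι → ℝ) → ℝ} (hf : ContDiff ℝ 2 f) (x : ι → ℝ) :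
    (hessian f x)ᵀ = hessian f x := by
  ext i j
  rw [transpose_apply, hessian_apply hf, hessian_apply hf]
  exact hf.contDiffAt.isSymmSndFDerivAt (by simp) _ _

theorem pderiv_add {f g : (ι → ℝ) → ℝ} {x : ι → ℝ} (hf : DifferentiableAt ℝ f x)
    (hg : DifferentiableAt ℝ g x) (i : ι) :
    pderiv (fun y => f y + g y) i x = pderiv f i x + pderiv g i x :=
  DFunLike.congr_fun (fderiv_add hf hg) _

theorem pderiv_comp_of_injective [Fintype κ] [DecidableEq κ] {e : κ → ι}
    (he : Function.Injective e) {g : (κ → ℝ) → ℝ} {z : ι → ℝ}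
    (hg : DifferentiableAt ℝ g (z ∘ e)) (i : κ) :
    pderiv (fun y => g (y ∘ e)) (e i) z = pderiv g i (z ∘ e) := by
  have h_single : (Pi.single (e i) 1 : ι → ℝ) ∘ e = Pi.single i 1 :=
    Function.update_comp_eq_of_injective (0 : ι → ℝ) he i 1
  rw [pderiv, fderiv_comp_reindex hg, h_single, pderiv]

theorem pderiv_comp_of_notMem_range [Finite κ] {e : κ → ι} {i : ι} (hi : i ∉ Set.range e)
    {g : (κ → ℝ) → ℝ} {z : ι → ℝ} (hg : DifferentiableAt ℝ g (z ∘ e)) :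
    pderiv (fun y => g (y ∘ e)) i z = 0 := by
  have h_single : (Pi.single i 1 : ι → ℝ) ∘ e = 0 :=
    Function.update_comp_eq_of_notMem_range (0 : ι → ℝ) 1 hi
  rw [pderiv, fderiv_comp_reindex hg, h_single, map_zero]

theorem pderiv_apply_div (m : ℝ) (i j : ι) (x : ι → ℝ) :
    pderiv (fun y => y j / m) i x = (1 : Matrix ι ι ℝ) i j / m := by
  have h := (hasFDerivAt_apply (𝕜 := ℝ) j x).mul_const m⁻¹
  simp only [div_eq_mul_inv]
  rw [pderiv, h.fderiv]
  simp [Pi.single_apply, Matrix.one_apply, eq_comm, mul_comm]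

end PartialDerivatives

section ClassicalHamiltonian

/-- The kinetic energy `p²/(2m)`, as a function of the momentum alone. -/
def kinetic (m : ℝ) (p : Fin d → ℝ) : ℝ := p ⬝ᵥ p / (2 * m)

theorem contDiff_kinetic {r : WithTop ℕ∞} (m : ℝ) : ContDiff ℝ r (kinetic (d := d) m) :=
  (ContDiff.sum fun i _ => (contDiff_apply ℝ ℝ i).mul (contDiff_apply ℝ ℝ i)).div_const _

theorem pderiv_kinetic (m : ℝ) (i : Fin d) (p : Fin d → ℝ) :
    pderiv (kinetic m) i p = p i / m := by
  have h_sq : HasFDerivAt (fun p : Fin d → ℝ => ∑ j, p j * p j) _ p :=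
    HasFDerivAt.fun_sum fun j _ => (hasFDerivAt_apply (𝕜 := ℝ) j p).mul (hasFDerivAt_apply j p)
  have h : HasFDerivAt (kinetic m) _ p := h_sq.mul_const (2 * m)⁻¹
  rw [pderiv, h.fderiv]
  simp [Pi.single_apply, ← two_mul]
  ring

theorem contDiff_Hcl {r : WithTop ℕ∞} (m : ℝ) {V : (Fin d → ℝ) → ℝ} (hV : ContDiff ℝ r V) :
    ContDiff ℝ r (Hcl m V) :=
  ((contDiff_kinetic m).comp (Pi.compRightL ℝ (fun _ : Fin d ⊕ Fin d => ℝ) Sum.inr).contDiff).add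
    (hV.comp (Pi.compRightL ℝ (fun _ : Fin d ⊕ Fin d => ℝ) Sum.inl).contDiff)

theorem pderiv_Hcl (m : ℝ) {V : (Fin d → ℝ) → ℝ} (hV : Differentiable ℝ V)
    (i : Fin d ⊕ Fin d) (z : PhaseSpace d) :
    pderiv (Hcl m V) i z = pderiv (fun y => kinetic m (y ∘ Sum.inr)) i z +
      pderiv (fun y => V (y ∘ Sum.inl)) i z :=
  pderiv_add
    (((contDiff_kinetic m).differentiable one_ne_zero).comp
      (Pi.compRightL ℝ (fun _ : Fin d ⊕ Fin d => ℝ) Sum.inr).differentiable z)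
    (hV.comp (Pi.compRightL ℝ (fun _ : Fin d ⊕ Fin d => ℝ) Sum.inl).differentiable z) i

theorem pderiv_Hcl_inl (m : ℝ) {V : (Fin d → ℝ) → ℝ} (hV : Differentiable ℝ V) (i : Fin d)
    (z : PhaseSpace d) : pderiv (Hcl m V) (.inl i) z = pderiv V i (z ∘ Sum.inl) := by
  rw [pderiv_Hcl m hV, pderiv_comp_of_injective Sum.inl_injective (hV _),
    pderiv_comp_of_notMem_range (by simp) ((contDiff_kinetic m).differentiable one_ne_zero _),
    zero_add]

theorem pderiv_Hcl_inr (m : ℝ) {V : (Fin d → ℝ) → ℝ} (hV : Differentiable ℝ V) (i : Fin d)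
    (z : PhaseSpace d) : pderiv (Hcl m V) (.inr i) z = z (.inr i) / m := by
  rw [pderiv_Hcl m hV, pderiv_comp_of_notMem_range (by simp) (hV _),
    pderiv_comp_of_injective Sum.inr_injective
      ((contDiff_kinetic m).differentiable one_ne_zero _), pderiv_kinetic, add_zero]
  rfl

theorem hessian_Hcl (m : ℝ) {V : (Fin d → ℝ) → ℝ} (hV : ContDiff ℝ 2 V) (z : PhaseSpace d) :
    hessian (Hcl m V) z = fromBlocks (hessian V (z ∘ Sum.inl)) 0 0 ((1 / m) • 1) := by
  have hV_diff : Differentiable ℝ V := hV.differentiable two_ne_zero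
  have hV' (j) : Differentiable ℝ (pderiv V j) :=
    (contDiff_pderiv (s := 1) hV (by norm_num) j).differentiable one_ne_zero
  ext i (j | j)
  · change pderiv (pderiv (Hcl m V) (.inl j)) i z = _
    rw [funext (pderiv_Hcl_inl m hV_diff j)]
    rcases i with i | i
    · exact pderiv_comp_of_injective Sum.inl_injective (hV' j _) i
    · exact pderiv_comp_of_notMem_range (by simp) (hV' j _)
  · change pderiv (pderiv (Hcl m V) (.inr j)) i z = _
    rw [funext (pderiv_Hcl_inr m hV_diff j), pderiv_apply_div]
    rcases i with i | i <;> simp [Matrix.one_apply, div_eq_inv_mul]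

end ClassicalHamiltonian

section SemiclassicalHamiltonian

theorem contDiffAt_trace_mul {E : Type*} [NormedAddCommGroup E] [NormedSpace ℝ E]
    {r : WithTop ℕ∞} {n : Type} [Fintype n] {f g : E → Matrix n n ℝ} {x : E}
    (hf : ContDiffAt ℝ r f x) (hg : ContDiffAt ℝ r g x) :
    ContDiffAt ℝ r (fun y => trace (f y * g y)) x := by
  simp only [trace, diag_apply]
  exact ContDiffAt.sum fun i _ => contDiffAt_matrix.1 (contDiffAt_matrix_mul hf hg) i i

/-- The extension `F(z) + (ħ/4) tr(Σ D²F(z))` of a function of `z` to the moments `(z, Σ)`. -/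
def semiclassical (ħ : ℝ) (F : PhaseSpace d → ℝ) (w : Moments d) : ℝ :=
  F w.1 + ħ / 4 * trace (w.2.1 * hessian F w.1)

theorem differentiable_semiclassical (ħ : ℝ) {F : PhaseSpace d → ℝ} (hF : ContDiff ℝ 3 F) :
    Differentiable ℝ (semiclassical ħ F) := fun w => by
  have hF_fst : ContDiffAt ℝ 1 (fun y : Moments d => F y.1) w :=
    ((hF.of_le (by norm_num)).comp contDiff_fst).contDiffAt
  have h_snd : ContDiffAt ℝ 1 (fun y : Moments d => y.2.1) w := contDiffAt_sym.1 contDiffAt_snd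
  have h_hessian : ContDiffAt ℝ 1 (fun y : Moments d => hessian F y.1) w :=
    (contDiff_hessian hF).contDiffAt.comp w contDiffAt_fst
  exact (hF_fst.add (contDiffAt_const.mul (contDiffAt_trace_mul h_snd h_hessian))).differentiableAt
    one_ne_zero

theorem eq_of_forall_trace_mul_eq {n : Type} [Fintype n] {A B : Sym n}
    (h : ∀ C : Sym n, trace (A.1 * C.1) = trace (B.1 * C.1)) : A = B := by
  refine sub_eq_zero.1 (eq_zero_of_trace_mul_self _ ?_)
  nth_rewrite 1 [Submodule.coe_sub]
  rw [Matrix.sub_mul, trace_sub, h, sub_self]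

theorem dSigma_semiclassical (ħ : ℝ) {F : PhaseSpace d → ℝ} (hF : ContDiff ℝ 3 F)
    (w : Moments d) : (dSigma (semiclassical ħ F) w).1 = (ħ / 4) • hessian F w.1 := by
  let D : Sym2 d := (ħ / 4) • ⟨_, hessian_transpose (hF.of_le (by norm_num)) w.1⟩
  suffices h : dSigma (semiclassical ħ F) w = D from congrArg Subtype.val h
  refine eq_of_forall_trace_mul_eq fun η => ?_
  have h_affine (t : ℝ) : semiclassical ħ F (w + t • (0, η)) =
      semiclassical ħ F w + t • trace (D.1 * η.1) := by
    simp only [semiclassical, D, Prod.fst_add, Prod.snd_add, Prod.smul_mk, smul_zero, add_zero,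
      Submodule.coe_add, Submodule.coe_smul, Matrix.add_mul, Matrix.smul_mul, trace_add,
      trace_smul, smul_eq_mul, trace_mul_comm (hessian F w.1)]
    ring
  have h_line := (differentiable_semiclassical ħ hF w).hasFDerivAt.hasLineDerivAt (0, η)
  rw [HasLineDerivAt, funext h_affine] at h_line
  have h := (fderiv_moments_apply (semiclassical ħ F) w (0, η)).symm.trans
    (h_line.unique (hasDerivAt_add_smul _ _))
  rwa [dotProduct_zero, zero_add] at h

theorem hamVecMoments_semiclassical_snd {ħ : ℝ} (hħ : ħ ≠ 0) {F : PhaseSpace d → ℝ}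
    (hF : ContDiff ℝ 3 F) (w : Moments d) :
    (hamVecMoments ħ (semiclassical ħ F) w).2.1 =
      JJ d * hessian F w.1 * w.2.1 - w.2.1 * hessian F w.1 * JJ d := by
  have h_cancel : 4 / ħ * (ħ / 4) = 1 := by field_simp
  simp only [hamVecMoments, adStar, Submodule.coe_smul, dSigma_semiclassical ħ hF,
    Matrix.mul_smul, Matrix.smul_mul, ← smul_sub, smul_smul, h_cancel, one_smul]

theorem dz_eq_pderiv {f : Moments d → ℝ} {w : Moments d} (hf : DifferentiableAt ℝ f w)
    (i : Fin d ⊕ Fin d) : dz f w i = pderiv (fun z => f (z, w.2)) i w.1 := by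
  have h : HasFDerivAt (fun z => f (z, w.2)) _ w.1 :=
    HasFDerivAt.comp (g := f) w.1 hf.hasFDerivAt (hasFDerivAt_prodMk_left w.1 w.2)
  exact (DFunLike.congr_fun h.fderiv _).symm

end SemiclassicalHamiltonian

section MomentHamiltonian

theorem trace_fromBlocks {k l : Type*} [Fintype k] [Fintype l] (A : Matrix k k ℝ)
    (B : Matrix k l ℝ) (C : Matrix l k ℝ) (D : Matrix l l ℝ) :
    trace (fromBlocks A B C D) = trace A + trace D :=
  Fintype.sum_sum_type _

theorem h_eq_semiclassical (ħ m : ℝ) {V : (Fin d → ℝ) → ℝ} (hV : ContDiff ℝ 2 V) :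
    h ħ m V = semiclassical ħ (Hcl m V) := by
  funext w
  rw [semiclassical, hessian_Hcl m hV]
  conv_rhs => rw [← fromBlocks_toBlocks w.2.1]
  rw [fromBlocks_multiply, trace_fromBlocks]
  simp only [h, Hcl, Matrix.mul_zero, add_zero, zero_add, Matrix.mul_smul, Matrix.mul_one,
    trace_add]
  ring

theorem differentiable_h (ħ m : ℝ) {V : (Fin d → ℝ) → ℝ} (hV : ContDiff ℝ 3 V) :
    Differentiable ℝ (h ħ m V) := by
  rw [h_eq_semiclassical ħ m (hV.of_le (by norm_num))]
  exact differentiable_semiclassical ħ (contDiff_Hcl m hV)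

theorem H_eqOn_h_comp_M (ħ m : ℝ) (V : (Fin d → ℝ) → ℝ) :
    Set.EqOn (H ħ m V) (h ħ m V ∘ M) (P d) := by
  intro x hx
  have hu : IsUnit (x.2.2.1).det := (isUnit_iff_isUnit_det _).1 (isUnit_of_mem_siegel hx)
  simp only [H, h, M, sigma, Function.comp_apply, toBlocks_fromBlocks₁₁, toBlocks_fromBlocks₂₂,
    pow_two, Matrix.mul_add, Matrix.mul_smul, trace_add, trace_smul, smul_add,
    nonsing_inv_mul_cancel_left _ _ hu]
  rw [← Matrix.mul_assoc, trace_mul_comm ((x.2.2.1)⁻¹ * x.2.1.1), Matrix.mul_assoc]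

/-- The potential `V(q) + (ħ/4) tr(A D²V(q))`, where `A` stands for `Σ₁₁`. -/
def effPotential (ħ : ℝ) (V : (Fin d → ℝ) → ℝ) (A : Matrix (Fin d) (Fin d) ℝ) (q : Fin d → ℝ) :
    ℝ :=
  V q + ħ / 4 * trace (A * hessian V q)

theorem differentiable_effPotential (ħ : ℝ) {V : (Fin d → ℝ) → ℝ} (hV : ContDiff ℝ 3 V)
    (A : Matrix (Fin d) (Fin d) ℝ) : Differentiable ℝ (effPotential ħ V A) := fun q =>
  (hV.differentiable three_ne_zero q).add (((contDiffAt_trace_mul contDiffAt_const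
    (contDiff_hessian hV).contDiffAt).differentiableAt one_ne_zero).const_mul _)

theorem dz_h (ħ m : ℝ) {V : (Fin d → ℝ) → ℝ} (hV : ContDiff ℝ 3 V) (w : Moments d)
    (i : Fin d ⊕ Fin d) :
    dz (h ħ m V) w i = pderiv (Hcl m (effPotential ħ V w.2.1.toBlocks₁₁)) i w.1 := by
  have h_split : (fun z => h ħ m V (z, w.2)) = fun z =>
      Hcl m (effPotential ħ V w.2.1.toBlocks₁₁) z +
        ħ / 4 * trace ((1 / m) • w.2.1.toBlocks₂₂) := by
    funext z
    simp only [h, Hcl, effPotential, trace_add]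
    ring
  rw [dz_eq_pderiv (differentiable_h ħ m hV w), h_split, pderiv, fderiv_add_const, pderiv]

theorem hamVecMoments_h_inl (ħ m : ℝ) {V : (Fin d → ℝ) → ℝ} (hV : ContDiff ℝ 3 V)
    (w : Moments d) (i : Fin d) :
    (hamVecMoments ħ (h ħ m V) w).1 (.inl i) = w.1 (.inr i) / m := by
  rw [← pderiv_Hcl_inr m (differentiable_effPotential ħ hV w.2.1.toBlocks₁₁), ← dz_h ħ m hV]
  simp [hamVecMoments, JJ, fromBlocks_mulVec]

theorem hamVecMoments_h_inr (ħ m : ℝ) {V : (Fin d → ℝ) → ℝ} (hV : ContDiff ℝ 3 V)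
    (w : Moments d) (i : Fin d) :
    (hamVecMoments ħ (h ħ m V) w).1 (.inr i) =
      -pderiv (effPotential ħ V w.2.1.toBlocks₁₁) i (w.1 ∘ Sum.inl) := by
  rw [← pderiv_Hcl_inl m (differentiable_effPotential ħ hV w.2.1.toBlocks₁₁), ← dz_h ħ m hV]
  simp [hamVecMoments, JJ, fromBlocks_mulVec, neg_mulVec]

theorem hamVecMoments_h_snd {ħ : ℝ} (hħ : ħ ≠ 0) (m : ℝ) {V : (Fin d → ℝ) → ℝ}
    (hV : ContDiff ℝ 3 V) (w : Moments d) :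
    (hamVecMoments ħ (h ħ m V) w).2.1 =
      JJ d * hessian (Hcl m V) w.1 * w.2.1 - w.2.1 * hessian (Hcl m V) w.1 * JJ d := by
  rw [h_eq_semiclassical ħ m (hV.of_le (by norm_num)),
    hamVecMoments_semiclassical_snd hħ (contDiff_Hcl m hV)]

end MomentHamiltonian

end GWP

end

theorem proposition5p1 (d : ℕ) (ħ m : ℝ) (hħ : 0 < ħ) (hm : 0 < m)
    (V : (Fin d → ℝ) → ℝ) (hV : ContDiff ℝ 3 V) :
    -- `Ψ` is an action of `G` on `𝒫`, and its infinitesimal generators exist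
    ((∀ x : GWP.P d, GWP.Psi 1 x = x) ∧
      (∀ (g g' : GWP.G d) (x : GWP.P d), GWP.Psi (g * g') x = GWP.Psi g (GWP.Psi g' x)) ∧
      (∀ (a : GWP.PhaseSpace d × GWP.Sym2 d) (x : GWP.P d),
        DifferentiableAt ℝ (GWP.orbitCurve a x) 0)) ∧
    -- (i) `M` is the momentum map (unique up to an additive constant), and it is equivariant
    (GWP.IsMomentumMap ħ (GWP.M (d := d)) ∧
      (∀ K : GWP.PModel d → GWP.Moments d, GWP.IsMomentumMap ħ K →
        ∃ c : GWP.Moments d, ∀ x ∈ GWP.P d, K x = GWP.M x + c) ∧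
      (∀ (g : GWP.G d) (x : GWP.P d),
        GWP.M (GWP.Psi g x).1 = GWP.momentAct g (GWP.M x.1))) ∧
    -- (ii) `M` is Poisson
    (∀ f g : GWP.Moments d → ℝ, ContDiff ℝ ∞ f → ContDiff ℝ ∞ g → ∀ x ∈ GWP.P d,
      GWP.poissonP ħ (f ∘ GWP.M) (g ∘ GWP.M) x = GWP.poissonMoments ħ f g (GWP.M x)) ∧
    -- (iii) `M` maps `𝒫` to `ℝ^{2d} × 𝒪` for the orbit `𝒪` that meets its image, and `M^* ω = Ω`
    (∀ μ : GWP.Sym2 d, (∃ c ∈ GWP.siegel d, GWP.sigma c ∈ GWP.coadjointOrbit μ) →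
      ∀ x ∈ GWP.P d, (GWP.M x).2 ∈ GWP.coadjointOrbit μ ∧
        (∀ u, fderiv ℝ GWP.M x u ∈ GWP.momentTangent (GWP.M x)) ∧
        ∀ u v, GWP.omega ħ (GWP.M x) (fderiv ℝ GWP.M x u) (fderiv ℝ GWP.M x v) =
          GWP.Omega ħ x u v) ∧
    -- (iv) the pushed-forward dynamics
    ((∀ w : GWP.Moments d, GWP.h ħ m V w =
        GWP.Hcl m V w.1 - ħ / 4 * -Matrix.trace (w.2.1 * GWP.hessian (GWP.Hcl m V) w.1)) ∧
      ∀ c ∈ GWP.siegel d,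
        -- the equation `X_h ∘ M = TM ∘ X_H` defines exactly one field `X_h` on `ℝ^{2d} × 𝒪_Σ`
        (∃! X : {w : GWP.Moments d // w.2 ∈ GWP.coadjointOrbit (GWP.sigma c)} → GWP.Moments d,
          ∀ x ∈ GWP.P d, ∀ w, w.1 = GWP.M x →
            X w = fderiv ℝ GWP.M x (GWP.hamVec ħ (GWP.H ħ m V) x)) ∧
        ∀ X : {w : GWP.Moments d // w.2 ∈ GWP.coadjointOrbit (GWP.sigma c)} → GWP.Moments d,
          (∀ x ∈ GWP.P d, ∀ w, w.1 = GWP.M x →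
            X w = fderiv ℝ GWP.M x (GWP.hamVec ħ (GWP.H ħ m V) x)) →
          ∀ w,
            -- it is the Hamiltonian vector field of `h` with respect to `ω`
            (∀ Y, GWP.IsHamVecMoments ħ (GWP.h ħ m V) w.1 Y ↔ Y = X w) ∧
            -- it is `ż = {z, h}`, `Σ̇ = (4/ħ)(𝕁 (δh/δΣ) Σ - Σ (δh/δΣ) 𝕁)`
            (∀ i, (X w).1 i = GWP.poissonR (fun w' => w'.1 i) (GWP.h ħ m V) w.1) ∧
            (X w).2 = (4 / ħ) • GWP.adStar (GWP.dSigma (GWP.h ħ m V) w.1) w.1.2 ∧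
            -- and concretely
            (∀ i, (X w).1 (Sum.inl i) = w.1.1 (Sum.inr i) / m) ∧
            (∀ i, (X w).1 (Sum.inr i) = -GWP.pderiv (fun q => V q + ħ / 4 *
              Matrix.trace (w.1.2.1.toBlocks₁₁ * GWP.hessian V q)) i (w.1.1 ∘ Sum.inl)) ∧
            (X w).2.1 = GWP.JJ d * GWP.hessian (GWP.Hcl m V) w.1.1 * w.1.2.1 -
              w.1.2.1 * GWP.hessian (GWP.Hcl m V) w.1.1 * GWP.JJ d) := by
  have hħ₀ : ħ ≠ 0 := hħ.ne'
  have h_diff : Differentiable ℝ (GWP.h ħ m V) := GWP.differentiable_h ħ m hV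
  refine ⟨⟨GWP.Psi_one, GWP.Psi_mul, fun a x => (GWP.hasDerivAt_orbitCurve a x).differentiableAt⟩,
    ⟨GWP.isMomentumMap_M ħ, fun K hK => hK.exists_eq_M_add hħ₀, GWP.M_Psi⟩,
    fun f g hf hg x hx => GWP.poissonP_comp_M hħ₀ hx (hf.differentiable (by simp) _)
      (hg.differentiable (by simp) _),
    fun μ ⟨c, hc, hcμ⟩ x hx => ⟨GWP.sigma_mem_coadjointOrbit hc hx hcμ,
      fun u => (GWP.mem_momentTangent_M_iff hx).2 ⟨u, rfl⟩, GWP.omega_fderiv_M ħ hx⟩,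
    fun w => ?_, fun c hc => ?_⟩
  · rw [GWP.h_eq_semiclassical ħ m (hV.of_le (by norm_num)), GWP.semiclassical]
    ring
  have h_iff {X} := GWP.forall_eq_fderiv_M_hamVec_iff (X := X) hħ₀ h_diff
    (GWP.H_eqOn_h_comp_M ħ m V) hc
  refine ⟨⟨fun w => GWP.hamVecMoments ħ (GWP.h ħ m V) w.1, h_iff.2 fun _ => rfl,
    fun X hX => funext (h_iff.1 hX)⟩, fun X hX w => ?_⟩
  rw [h_iff.1 hX w]
  exact ⟨fun Y => GWP.isHamVecMoments_iff hħ₀ h_diff hc w.2,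
    fun i => (GWP.poissonR_coord _ _ i).symm, rfl, GWP.hamVecMoments_h_inl ħ m hV w.1,
    GWP.hamVecMoments_h_inr ħ m hV w.1, GWP.hamVecMoments_h_snd hħ₀ m hV w.1⟩
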